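/- **Conventions.** Let $\mathcal T$ be a triangulated category with arbitrary coproducts, $n\ge 1$, and let $N$ be a compact object of $\mathcal T$, i.e. $\mathcal T(N,-)$ preserves coproducts. Put $\mathcal T(N,X)_k=\mathcal T(N[k],X)$; then $\Lambda=\mathcal T(N,N)_*$ is a graded ring and each $\mathcal T(N,X)_*$ is a graded right $\Lambda$-module. Modules are graded right modules, $M[t]_k=M_{k-t}$, and $\operatorname{Ext}^{s,t}_\Lambda(M,M')=\operatorname{Ext}^s_\Lambda(M,M'[t])$ in the sense of Yoneda. A graded group is $n$-sparse if it is concentrated in degrees divisible by $n$. Assume that $\Lambda$ is $n$-sparse. *Mac Lane cohomology.* $F(\Lambda,n)$ is the category of finitely generated free $n$-sparse $\Lambda$-modules and $\mathrm{HML}^{s,t}_{n\text{-sp}}(\Lambda)=H^s\big(F(\Lambda,n),\operatorname{Hom}_\Lambda(-,-[t])\big)$ is the cohomology of the complex of functions $c$ assigning to composable maps $X_0\xleftarrow{g_1}X_1\leftarrow\cdots\xleftarrow{g_s}X_s$ an element of $\operatorname{Hom}_\Lambda(X_s,X_0[t])$, with $$\delta c(g_1,\dots,g_{s+1})=g_1[t]\,c(g_2,\dots,g_{s+1})+\sum_{i=1}^{s}(-1)^i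 c(\dots,g_ig_{i+1},\dots)+(-1)^{s+1}c(g_1,\dots,g_s)\,g_{s+1}.$$ A cochain is normalized if it vanishes when some $g_i=0$. *Cup product.* Let $f\colon M\to M'$ be a map, $\gamma\in \mathrm{HML}^{s,t}_{n\text{-sp}}(\Lambda)$ with $s\ge 2$, $\cdots\to M_1\xrightarrow{\lambda_1}M_0\xrightarrow{\lambda_0}M\to0$ a resolution by objects of $F(\Lambda,n)$, and $c$ a normalized cocycle representing $\gamma$. There is a $\tau\colon\ker\lambda_{s-1}\to M[t]$ with $\lambda_0[t]\,c(\lambda_1,\dots,\lambda_s)=\tau\lambda_s$, and $$f\cup\gamma=(-1)^{\frac{n(n+1)}2}\,(f[t]\,\tau)_*\big[0\to\ker\lambda_{s-1}\to M_{s-1}\to\cdots\to M_0\to M\to0\big]\in\operatorname{Ext}^{s,t}_\Lambda(M,M').$$ *Toda brackets.* For maps $X_{m-1}\xrightarrow{\lambda_{m-1}}\cdots\xrightarrow{\lambda_1}X_0$ in $\mathcal T$, an $m$-filtered object $X\in\{\lambda_1,\dots,\lambda_{m-1}\}$ consists of maps $0=F_0\xrightarrow{i_0}F_1\to\cdots\to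 F_m=X$ and distinguished triangles $F_j\xrightarrow{i_j}F_{j+1}\xrightarrow{p_{j+1}}X_j[j]\xrightarrow{d_j}F_j[1]$ with $p_j[1]\,d_j=\lambda_j[j]$ for $1\le j<m$; let $\sigma'_X\colon X_0\cong F_1\to X$ and $\sigma_X=p_m$. The Toda bracket $\langle\lambda_1,\dots,\lambda_{n+2}\rangle\subseteq\mathcal T(X_{n+2}[n],X_0)$ is the set of all $\gamma_0\gamma_{n+2}$, where $X\in\{\lambda_2,\dots,\lambda_{n+1}\}$ is an $(n+1)$-filtered object and $\gamma_0\colon X\to X_0$, $\gamma_{n+2}\colon X_{n+2}[n]\to X$ satisfy $\gamma_0\sigma'_X=\lambda_1$ and $\sigma_X\gamma_{n+2}=\lambda_{n+2}[n]$. For maps in $F(\Lambda,n)$ it is defined by lifting them along the equivalence $\mathcal T(N,-)_*$ from the category of finite sums of copies of $N$ shifted by multiples of $n$. *Obstruction class.* An $N$-exact $(n+1)$-Postnikov system for $M$ consists of objects $X_0,\dots,X_{n+1}$ that are coproducts of shifted copies of $N$, objects $Y_0=X_0,Y_1,\dots,Y_n$, distinguished triangles $Y_j\xrightarrow{\pi_j}X_j\xrightarrow{\iota_j}Y_{j-1}\xrightarrow{\alpha_j}Y_j[1]$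 for $1\le j\le n$, a map $\iota_{n+1}\colon X_{n+1}\to Y_n$ and an epimorphism $\mathcal T(N,X_0)_*\to M$ such that, with $d_1=\iota_1$ and $d_j=\pi_{j-1}\iota_j$ for $j\ge 2$, the sequence $\mathcal T(N,X_{n+1})_*\xrightarrow{d_{n+1}}\cdots\xrightarrow{d_1}\mathcal T(N,X_0)_*\to M\to0$ is exact. Its obstruction class in $\operatorname{Ext}^{n+2,-n}_\Lambda(M,M)$ is the class of $$0\to M[-n]\xrightarrow{\eta}\mathcal T(N,Y_n)_*\xrightarrow{\pi_n}\mathcal T(N,X_n)_*\xrightarrow{d_n}\cdots\xrightarrow{d_1}\mathcal T(N,X_0)_*\to M\to0,$$ where $\eta$ is induced by $\alpha_n\cdots\alpha_1\colon X_0[-n]\to Y_n$. **Theorem.** Let $M$ be a $\Lambda$-module with a resolution $\cdots\to M_1\xrightarrow{\lambda'_1}M_0\xrightarrow{\lambda'_0}M\to0$ by finitely generated free $n$-sparse $\Lambda$-modules, and let $\gamma\in\mathrm{HML}^{n+2,-n}_{n\text{-sp}}(\Lambda)$ be a class whose evaluation $\gamma(\lambda'_1,\dots,\lambda'_{n+2})$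 is the Toda bracket $\langle\lambda'_1,\dots,\lambda'_{n+2}\rangle$, i.e. $c(\lambda'_1,\dots,\lambda'_{n+2})\in\langle\lambda'_1,\dots,\lambda'_{n+2}\rangle$ for some normalized cocycle $c$ representing $\gamma$. Then there are $N$-exact $(n+1)$-Postnikov systems for $M$, they all have the same obstruction class $\kappa_{n+2}(M)\in\operatorname{Ext}^{n+2,-n}_\Lambda(M,M)$, the product $\mathrm{id}_M\cup\gamma$ does not depend on the choices made, and $$\mathrm{id}_M\cup\gamma=\kappa_{n+2}(M)\in\operatorname{Ext}^{n+2,-n}_\Lambda(M,M).$$ -/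

import Mathlib

open CategoryTheory CategoryTheory.Limits CategoryTheory.Pretriangulated Opposite

universe v u

/-! ## Graded rings and graded right modules -/

/-- A `ℤ`-graded ring `Λ = (Λ_i)`. The product is `Λ_i × Λ_j → Λ_k` for `i + j = k`. -/
structure GrRing where
  carrier : ℤ → Type v
  [grp : ∀ i, AddCommGroup (carrier i)]
  one : carrier 0
  mul : ∀ {i j k : ℤ}, i + j = k → carrier i → carrier j → carrier k
  add_mul : ∀ {i j k : ℤ} (h : i + j = k) (a a' : carrier i) (b : carrier j),
    mul h (a + a') b = mul h a b + mul h a' b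
  mul_add : ∀ {i j k : ℤ} (h : i + j = k) (a : carrier i) (b b' : carrier j),
    mul h a (b + b') = mul h a b + mul h a b'
  one_mul : ∀ {i : ℤ} (a : carrier i), mul (zero_add i) one a = a
  mul_one : ∀ {i : ℤ} (a : carrier i), mul (add_zero i) a one = a
  mul_assoc : ∀ {i j l ij jl k : ℤ} (h₁ : i + j = ij) (h₂ : ij + l = k) (h₃ : j + l = jl)
    (h₄ : i + jl = k) (a : carrier i) (b : carrier j) (c : carrier l),
    mul h₂ (mul h₁ a b) c = mul h₄ a (mul h₃ b c)

attribute [instance] GrRing.grp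

/-- A graded right module over the graded ring `Λ`. -/
structure GrMod (Λ : GrRing.{v}) where
  carrier : ℤ → Type v
  [grp : ∀ i, AddCommGroup (carrier i)]
  smul : ∀ {i j k : ℤ}, i + j = k → carrier i → Λ.carrier j → carrier k
  add_smul : ∀ {i j k : ℤ} (h : i + j = k) (x x' : carrier i) (a : Λ.carrier j),
    smul h (x + x') a = smul h x a + smul h x' a
  smul_add : ∀ {i j k : ℤ} (h : i + j = k) (x : carrier i) (a a' : Λ.carrier j),
    smul h x (a + a') = smul h x a + smul h x a'
  smul_one : ∀ {i : ℤ} (x : carrier i), smul (add_zero i) x Λ.one = x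
  smul_assoc : ∀ {i j l ij jl k : ℤ} (h₁ : i + j = ij) (h₂ : ij + l = k) (h₃ : j + l = jl)
    (h₄ : i + jl = k) (x : carrier i) (a : Λ.carrier j) (b : Λ.carrier l),
    smul h₂ (smul h₁ x a) b = smul h₄ x (Λ.mul h₃ a b)

attribute [instance] GrMod.grp

/-- A graded abelian group is `n`-sparse if it is concentrated in degrees divisible by `n`. -/
def IsSparse (n : ℕ) (G : ℤ → Type v) : Prop :=
  ∀ k : ℤ, ¬ (n : ℤ) ∣ k → Subsingleton (G k)

namespace GrMod

variable {Λ : GrRing.{v}}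

/-- Morphisms of graded right modules (of degree `0`). -/
@[ext]
structure Hom (M N : GrMod Λ) where
  app : ∀ k : ℤ, M.carrier k →+ N.carrier k
  map_smul : ∀ {i j k : ℤ} (h : i + j = k) (x : M.carrier i) (a : Λ.carrier j),
    app k (M.smul h x a) = N.smul h (app i x) a

instance : Category.{v} (GrMod Λ) where
  Hom := Hom
  id M := { app := fun _ => AddMonoidHom.id _, map_smul := fun _ _ _ => rfl }
  comp f g :=
    { app := fun k => (g.app k).comp (f.app k)
      map_smul := fun h x a => by simp [f.map_smul, g.map_smul] }

@[ext]
theorem hom_ext {M N : GrMod Λ} {f g : M ⟶ N}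
    (h : ∀ k (x : M.carrier k), f.app k x = g.app k x) : f = g :=
  Hom.ext (funext fun k => AddMonoidHom.ext (h k))

@[simp]
theorem id_app (M : GrMod Λ) (k : ℤ) (x : M.carrier k) : (𝟙 M : M ⟶ M).app k x = x := rfl

@[simp]
theorem comp_app {M N P : GrMod Λ} (f : M ⟶ N) (g : N ⟶ P) (k : ℤ) (x : M.carrier k) :
    (f ≫ g).app k x = g.app k (f.app k x) := rfl

theorem zero_smul (M : GrMod Λ) {i j k : ℤ} (h : i + j = k) (a : Λ.carrier j) :
    M.smul h (0 : M.carrier i) a = 0 := by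
  have := M.add_smul h 0 0 a
  simpa using this

theorem neg_smul (M : GrMod Λ) {i j k : ℤ} (h : i + j = k) (x : M.carrier i)
    (a : Λ.carrier j) : M.smul h (-x) a = -M.smul h x a := by
  have := M.add_smul h (-x) x a
  rw [neg_add_cancel, zero_smul] at this
  exact eq_neg_of_add_eq_zero_left this.symm

/-- The action of a fixed homogeneous scalar, as an additive map. -/
def smulHom (M : GrMod Λ) {i j k : ℤ} (h : i + j = k) (a : Λ.carrier j) :
    M.carrier i →+ M.carrier k where
  toFun x := M.smul h x a
  map_zero' := M.zero_smul h a
  map_add' x x' := M.add_smul h x x' a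

section

variable {M N : GrMod Λ}

instance : Zero (Hom M N) := ⟨{ app := 0, map_smul := fun h x a => by simp [zero_smul] }⟩
instance : Add (Hom M N) :=
  ⟨fun f g => { app := f.app + g.app
                map_smul := fun h x a => by
                  simp [f.map_smul, g.map_smul, add_smul] }⟩
instance : Neg (Hom M N) :=
  ⟨fun f => { app := -f.app
              map_smul := fun h x a => by simp [f.map_smul, neg_smul] }⟩

instance : AddCommGroup (Hom M N) where
  add_assoc f g h := Hom.ext (add_assoc _ _ _)
  zero_add f := Hom.ext (zero_add _)
  add_zero f := Hom.ext (add_zero _)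
  add_comm f g := Hom.ext (add_comm _ _)
  neg_add_cancel f := Hom.ext (neg_add_cancel _)
  nsmul := nsmulRec
  zsmul := zsmulRec

end

instance : Preadditive (GrMod Λ) where
  homGroup M N := inferInstanceAs (AddCommGroup (Hom M N))
  add_comp _ _ _ f f' g := by
    ext k x
    exact map_add (g.app k) _ _
  comp_add _ _ _ _ _ _ := rfl

/-- The shift `M[t]`, with `M[t]_k = M_{k - t}`. -/
def shiftObj (t : ℤ) (M : GrMod Λ) : GrMod Λ where
  carrier k := M.carrier (k - t)
  smul h x a := M.smul (by omega) x a
  add_smul h := M.add_smul _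
  smul_add h := M.smul_add _
  smul_one {i} x := M.smul_one x
  smul_assoc h₁ h₂ h₃ h₄ := M.smul_assoc _ _ h₃ _

/-- The shift functor `M ↦ M[t]` on graded right `Λ`-modules. -/
def shift (t : ℤ) : GrMod Λ ⥤ GrMod Λ where
  obj M := M.shiftObj t
  map f := { app := fun k => f.app (k - t), map_smul := fun _ x a => f.map_smul _ x a }

/-- The kernel of a morphism of graded modules. -/
def ker {M N : GrMod Λ} (f : M ⟶ N) : GrMod Λ where
  carrier k := (f.app k).ker
  smul {i j k} h x a := ⟨M.smul h x.1 a, by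
    have hx : f.app i x.1 = 0 := x.2
    change f.app k _ = 0
    rw [f.map_smul, hx, zero_smul]⟩
  add_smul h x x' a := Subtype.ext (M.add_smul h x.1 x'.1 a)
  smul_add h x a a' := Subtype.ext (M.smul_add h x.1 a a')
  smul_one x := Subtype.ext (M.smul_one x.1)
  smul_assoc h₁ h₂ h₃ h₄ x a b := Subtype.ext (M.smul_assoc h₁ h₂ h₃ h₄ x.1 a b)

/-- The inclusion of the kernel. -/
def kerι {M N : GrMod Λ} (f : M ⟶ N) : ker f ⟶ M where
  app k := (f.app k).ker.subtype
  map_smul _ _ _ := rfl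

/-- The relations `(f b, - g b)` that define the pushout. -/
def pushoutRel {B B' P : GrMod Λ} (f : B ⟶ B') (g : B ⟶ P) (k : ℤ) :
    AddSubgroup (B'.carrier k × P.carrier k) :=
  ((f.app k).prod (-(g.app k))).range

/-- The pushout `(B' ⊕ P) / {(f b, - g b)}` of `f : B ⟶ B'` and `g : B ⟶ P`. -/
def pushout {B B' P : GrMod Λ} (f : B ⟶ B') (g : B ⟶ P) : GrMod Λ where
  carrier k := (B'.carrier k × P.carrier k) ⧸ pushoutRel f g k
  smul {i j k} h x a :=
    QuotientAddGroup.map (pushoutRel f g i) (pushoutRel f g k)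
      ((B'.smulHom h a).prodMap (P.smulHom h a))
      (by
        rintro _ ⟨b, rfl⟩
        refine ⟨B.smul h b a, ?_⟩
        change (_, _) = (B'.smul h _ a, P.smul h (-(g.app i b)) a)
        rw [neg_smul, ← g.map_smul]
        exact Prod.ext (f.map_smul h b a) rfl) x
  add_smul h x x' a := map_add _ x x'
  smul_add h x a a' := by
    induction x using QuotientAddGroup.induction_on with
    | H x =>
      exact congrArg (QuotientAddGroup.mk)
        (Prod.ext (B'.smul_add h x.1 a a') (P.smul_add h x.2 a a'))
  smul_one x := by
    induction x using QuotientAddGroup.induction_on with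
    | H x => exact congrArg (QuotientAddGroup.mk) (Prod.ext (B'.smul_one x.1) (P.smul_one x.2))
  smul_assoc h₁ h₂ h₃ h₄ x a b := by
    induction x using QuotientAddGroup.induction_on with
    | H x =>
      exact congrArg (QuotientAddGroup.mk)
        (Prod.ext (B'.smul_assoc h₁ h₂ h₃ h₄ x.1 a b) (P.smul_assoc h₁ h₂ h₃ h₄ x.2 a b))

/-- The map `B' ⟶ pushout f g`. -/
def pushoutInl {B B' P : GrMod Λ} (f : B ⟶ B') (g : B ⟶ P) : B' ⟶ pushout f g where
  app k := (QuotientAddGroup.mk' (pushoutRel f g k)).comp (AddMonoidHom.inl _ _)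
  map_smul {i j k} h x a := by
    refine congrArg (QuotientAddGroup.mk) (Prod.ext rfl ?_)
    exact (P.zero_smul h a).symm

/-- The map out of the pushout that is `0` on `B'` and `p` on `P`. -/
def pushoutDesc {B B' P E : GrMod Λ} (f : B ⟶ B') (g : B ⟶ P) (p : P ⟶ E)
    (hp : ∀ k (b : B.carrier k), p.app k (g.app k b) = 0) : pushout f g ⟶ E where
  app k := QuotientAddGroup.lift (pushoutRel f g k)
    ((p.app k).comp (AddMonoidHom.snd _ _)) (by
      rintro _ ⟨b, rfl⟩
      change p.app k (-(g.app k b)) = 0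
      rw [map_neg, hp, neg_zero])
  map_smul {i j k} h x a := by
    induction x using QuotientAddGroup.induction_on with
    | H x => exact p.map_smul h x.2 a

/-- `F` is a finitely generated free graded module, i.e. a finite sum of shifts `Λ[d_i]`: there is
a finite homogeneous basis `e_i ∈ F_{d_i}`. -/
def IsFinFree (F : GrMod Λ) : Prop :=
  ∃ (m : ℕ) (d : Fin m → ℤ) (e : ∀ i, F.carrier (d i)), ∀ k : ℤ,
    Function.Bijective fun a : (∀ i, Λ.carrier (k - d i)) =>
      ∑ i, F.smul (add_sub_cancel (d i) k) (e i) (a i)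

end GrMod

/-! ## Yoneda extensions -/

section Yoneda

variable {Λ : GrRing.{v}}

/-- `x ∈ E_i` is a cycle of the augmented sequence `⋯ → E_1 → E_0 → A`: it is killed by
`E_i → E_{i-1}` if `i > 0`, and by the augmentation `E_0 → A` if `i = 0`. -/
def GrMod.IsCycle {A : GrMod Λ} (E : ℕ → GrMod Λ) (d : ∀ i, E (i + 1) ⟶ E i) (aug : E 0 ⟶ A) :
    ∀ (i : ℕ) {k : ℤ}, (E i).carrier k → Prop
  | 0, k, x => aug.app k x = 0
  | i + 1, k, x => (d i).app k x = 0

/-- The data of a sequence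
`B --inc--> P --dTop--> E_q --d--> E_{q-1} → ⋯ --d--> E_0 --aug--> A` of graded modules.
The objects `E_i` with `i > q` and the maps `d i` with `i ≥ q` play no role. -/
structure YSeq (q : ℕ) (A B : GrMod Λ) where
  E : ℕ → GrMod Λ
  d : ∀ i, E (i + 1) ⟶ E i
  aug : E 0 ⟶ A
  P : GrMod Λ
  dTop : P ⟶ E q
  inc : B ⟶ P

/-- Exactness of `0 → B → P → E_q → ⋯ → E_0 → A → 0`. -/
structure YSeq.IsExact {q : ℕ} {A B : GrMod Λ} (S : YSeq q A B) : Prop where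
  aug_surjective : ∀ k, Function.Surjective (S.aug.app k)
  exact_E : ∀ i, i < q → ∀ (k : ℤ) (x : (S.E i).carrier k),
    GrMod.IsCycle S.E S.d S.aug i x ↔ ∃ y, (S.d i).app k y = x
  exact_top : ∀ (k : ℤ) (x : (S.E q).carrier k),
    GrMod.IsCycle S.E S.d S.aug q x ↔ ∃ y, S.dTop.app k y = x
  exact_P : ∀ (k : ℤ) (y : S.P.carrier k), S.dTop.app k y = 0 ↔ ∃ b, S.inc.app k b = y
  inc_injective : ∀ k, Function.Injective (S.inc.app k)

/-- A Yoneda extension `0 → B → P → E_q → ⋯ → E_0 → A → 0` of length `q + 2`. -/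
structure YExtension (q : ℕ) (A B : GrMod Λ) extends YSeq q A B where
  exact : toYSeq.IsExact

/-- A morphism of Yoneda extensions which is the identity on both ends. -/
structure YExtension.Hom {q : ℕ} {A B : GrMod Λ} (S S' : YExtension q A B) where
  f : ∀ i, i ≤ q → (S.E i ⟶ S'.E i)
  fP : S.P ⟶ S'.P
  comm_aug : f 0 (Nat.zero_le q) ≫ S'.aug = S.aug
  comm_d : ∀ i (h : i + 1 ≤ q), f (i + 1) h ≫ S'.d i = S.d i ≫ f i (Nat.le_of_succ_le h)
  comm_top : fP ≫ S'.dTop = S.dTop ≫ f q le_rfl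
  comm_inc : S.inc ≫ fP = S'.inc

/-- The Yoneda `Ext^{q+2}_Λ(A, B)`: extensions of length `q + 2` modulo the equivalence relation
generated by morphisms of extensions which are the identity on both ends. -/
def YExt (q : ℕ) (A B : GrMod Λ) : Type (v + 1) :=
  Quot fun S S' : YExtension q A B => Nonempty (S.Hom S')

/-- The class of an extension. -/
def YExtension.toExt {q : ℕ} {A B : GrMod Λ} (S : YExtension q A B) : YExt q A B :=
  Quot.mk _ S

/-- The extension `f_* S` obtained from `S` by pushout along `f : B ⟶ B'`. -/
def YExtension.push {q : ℕ} {A B B' : GrMod Λ} (S : YExtension q A B) (f : B ⟶ B') :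
    YExtension q A B' where
  E := S.E
  d := S.d
  aug := S.aug
  P := GrMod.pushout f S.inc
  dTop := GrMod.pushoutDesc f S.inc S.dTop fun k b => (S.exact.exact_P k _).2 ⟨b, rfl⟩
  inc := GrMod.pushoutInl f S.inc
  exact :=
    { aug_surjective := S.exact.aug_surjective
      exact_E := S.exact.exact_E
      exact_top := fun k x => by
        rw [S.exact.exact_top]
        constructor
        · rintro ⟨y, rfl⟩
          exact ⟨QuotientAddGroup.mk (0, y), rfl⟩
        · rintro ⟨y, rfl⟩
          induction y using QuotientAddGroup.induction_on with
          | H y => exact ⟨y.2, rfl⟩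
      exact_P := fun k y => by
        constructor
        · induction y using QuotientAddGroup.induction_on with
          | H y =>
            intro hy
            obtain ⟨b, hb⟩ := (S.exact.exact_P k y.2).1 hy
            refine ⟨y.1 + f.app k b, (QuotientAddGroup.eq).2 ⟨-b, ?_⟩⟩
            refine Prod.ext ?_ ?_
            · change f.app k (-b) = -(y.1 + f.app k b) + y.1
              rw [map_neg]
              abel
            · change -(S.inc.app k (-b)) = -0 + y.2
              rw [map_neg, hb]
              simp
        · rintro ⟨b, rfl⟩
          exact map_zero (S.dTop.app k)
      inc_injective := fun k => by
        refine (injective_iff_map_eq_zero _).2 fun b hb => ?_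
        obtain ⟨c, hc⟩ := (QuotientAddGroup.eq_zero_iff _).1 hb
        have h1 : f.app k c = b := congrArg Prod.fst hc
        have h2 : -(S.inc.app k c) = 0 := congrArg Prod.snd hc
        have h3 : c = 0 := S.exact.inc_injective k (by rw [map_zero]; exact neg_eq_zero.1 h2)
        rw [← h1, h3, map_zero] }

end Yoneda

/-! ## Cohomology of categories -/

section BW

variable {C : Type u} [Category.{v} C]

/-- An `s`-simplex of the nerve of `C`: a sequence `X_0 ←g_1- X_1 ← ⋯ ←g_s- X_s`, encoded as the
sequence `op X_0 ⟶ op X_1 ⟶ ⋯ ⟶ op X_s` in `Cᵒᵖ`. -/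
abbrev Chain (C : Type u) [Category.{v} C] (s : ℕ) := ComposableArrows Cᵒᵖ s

/-- The face that omits `X_i`. -/
def Chain.face {s : ℕ} (F : Chain C (s + 1)) (i : Fin (s + 2)) : Chain C s :=
  (Fin.succAboveOrderEmb i).monotone.functor ⋙ F

/-- Cochains of degree `s` with coefficients in a bimodule `D`: functions
`c(g_1, …, g_s) ∈ D(X_s, X_0)`. -/
abbrev Cochain (D : Cᵒᵖ ⥤ C ⥤ AddCommGrpCat.{v}) (s : ℕ) :=
  ∀ F : Chain C s, (D.obj (F.obj (Fin.last s))).obj (F.obj 0).unop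

/-- The value of the cochain `c` on the face omitting `X_i`, transported to `D(X_{s+1}, X_0)`. This
is `(g_1)_* c(g_2, …, g_{s+1})` for `i = 0`, `c(g_1, …, g_i g_{i+1}, …, g_{s+1})` for
`0 < i < s + 1`, and `(g_{s+1})^* c(g_1, …, g_s)` for `i = s + 1`. -/
def faceValue (D : Cᵒᵖ ⥤ C ⥤ AddCommGrpCat.{v}) {s : ℕ} (i : Fin (s + 2))
    (F : Chain C (s + 1)) :
    (D.obj ((F.face i).obj (Fin.last s))).obj ((F.face i).obj 0).unop ⟶
      (D.obj (F.obj (Fin.last (s + 1)))).obj (F.obj 0).unop :=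
  (D.map (F.map (homOfLE (Fin.le_last (i.succAbove (Fin.last s)))))).app _ ≫
    (D.obj _).map (F.map (homOfLE (Fin.zero_le (i.succAbove 0)))).unop

/-- The coboundary `δ c (g_1, …, g_{s+1}) = (g_1)_* c(g_2, …, g_{s+1}) +
∑_{i=1}^{s} (-1)^i c(…, g_i g_{i+1}, …) + (-1)^{s+1} (g_{s+1})^* c(g_1, …, g_s)`. -/
def coboundary (D : Cᵒᵖ ⥤ C ⥤ AddCommGrpCat.{v}) (s : ℕ) : Cochain D s →+ Cochain D (s + 1) where
  toFun c F := ∑ i : Fin (s + 2), ((-1 : ℤ) ^ (i : ℕ)) • (faceValue D i F) (c (F.face i))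
  map_zero' := by
    funext F
    simp
  map_add' c c' := by
    funext F
    simp [Finset.sum_add_distrib]

/-- The group of cocycles of degree `s`. -/
def cocycles (D : Cᵒᵖ ⥤ C ⥤ AddCommGrpCat.{v}) (s : ℕ) : AddSubgroup (Cochain D s) :=
  (coboundary D s).ker

/-- The group of coboundaries of degree `s`. -/
def coboundaries (D : Cᵒᵖ ⥤ C ⥤ AddCommGrpCat.{v}) : ∀ s : ℕ, AddSubgroup (Cochain D s)
  | 0 => ⊥
  | s + 1 => (coboundary D s).range

/-- The cohomology `H^s(C, D)` of the category `C` with coefficients in the bimodule `D`. -/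
def CatCohomology (D : Cᵒᵖ ⥤ C ⥤ AddCommGrpCat.{v}) (s : ℕ) :=
  cocycles D s ⧸ (coboundaries D s).addSubgroupOf (cocycles D s)

/-- A cochain is normalized if `c(g_1, …, g_s) = 0` whenever some `g_i` is zero. -/
def IsNormalized [HasZeroMorphisms C] {D : Cᵒᵖ ⥤ C ⥤ AddCommGrpCat.{v}} {s : ℕ}
    (c : Cochain D s) : Prop :=
  ∀ F : Chain C s, (∃ i : Fin s, (F.map (homOfLE i.castSucc_le_succ)).unop = 0) → c F = 0

/-- `c` is a normalized cocycle which represents the cohomology class `γ`. -/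
def NormalizedRep [HasZeroMorphisms C] {D : Cᵒᵖ ⥤ C ⥤ AddCommGrpCat.{v}} {s : ℕ}
    (c : Cochain D s) (γ : CatCohomology D s) : Prop :=
  IsNormalized c ∧ ∃ hc : c ∈ cocycles D s, QuotientAddGroup.mk ⟨c, hc⟩ = γ

end BW

/-! ## Graded Mac Lane cohomology and the cup product -/

section MacLane

variable {Λ : GrRing.{v}}

/-- The property defining `F(Λ, n)`: finitely generated free and `n`-sparse. -/
def freeSparse (Λ : GrRing.{v}) (n : ℕ) : ObjectProperty (GrMod Λ) :=
  fun F => F.IsFinFree ∧ IsSparse n F.carrier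

/-- The category `F(Λ, n)` of finitely generated free `n`-sparse graded right `Λ`-modules. -/
abbrev FreeCat (Λ : GrRing.{v}) (n : ℕ) := (freeSparse Λ n).FullSubcategory

/-- The bimodule `Hom_Λ(-, - ⊗_Λ Λ[t]) = Hom_Λ(-, -[t])` over `F(Λ, n)`. -/
def homBimodule (Λ : GrRing.{v}) (n : ℕ) (t : ℤ) :
    (FreeCat Λ n)ᵒᵖ ⥤ FreeCat Λ n ⥤ AddCommGrpCat.{v} where
  obj X :=
    { obj := fun Y => AddCommGrpCat.of (X.unop.obj ⟶ (GrMod.shift t).obj Y.obj)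
      map := fun g => AddCommGrpCat.ofHom
        (Preadditive.rightComp X.unop.obj ((GrMod.shift t).map g.hom)) }
  map f :=
    { app := fun Y => AddCommGrpCat.ofHom
        (Preadditive.leftComp ((GrMod.shift t).obj Y.obj) f.unop.hom) }

/-- The graded `n`-split Mac Lane cohomology `HML^{s,t}_{n-sp}(Λ)`. -/
abbrev HML (Λ : GrRing.{v}) (n s : ℕ) (t : ℤ) := CatCohomology (homBimodule Λ n t) s

/-- A resolution `⋯ → M_1 → M_0 → M → 0` of `M` by objects `M_i` of `F(Λ, n)`; the map `d i` is
`λ_{i+1} : M_{i+1} → M_i`, and `aug` is `λ_0 : M_0 → M`. -/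
structure FreeResolution (n : ℕ) (M : GrMod Λ) where
  F : ℕ → FreeCat Λ n
  d : ∀ i, F (i + 1) ⟶ F i
  aug : (F 0).obj ⟶ M
  aug_surjective : ∀ k, Function.Surjective (aug.app k)
  exact : ∀ (i : ℕ) (k : ℤ) (x : (F i).obj.carrier k),
    GrMod.IsCycle (fun i => (F i).obj) (fun i => (d i).hom) aug i x ↔ ∃ y, (d i).hom.app k y = x

namespace FreeResolution

variable {n : ℕ} {M : GrMod Λ} (R : FreeResolution n M)

/-- The simplex `(λ_1, …, λ_s)`. -/
noncomputable def chain (s : ℕ) : Chain (FreeCat Λ n) s :=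
  ComposableArrows.mkOfObjOfMapSucc (fun i : Fin (s + 1) => op (R.F i)) fun i => (R.d i).op

/-- The value `c(λ_1, …, λ_s) : M_s → M_0[t]` of a cochain. -/
noncomputable def eval {s : ℕ} {t : ℤ} (c : Cochain (homBimodule Λ n t) s) :
    (R.F s).obj ⟶ (GrMod.shift t).obj (R.F 0).obj :=
  c (R.chain s)

/-- The extension `0 → ker λ_{q+1} → M_{q+1} → ⋯ → M_0 → M → 0` of length `q + 2`. -/
def truncation (q : ℕ) : YExtension q M (GrMod.ker (R.d q).hom) where
  E i := (R.F i).obj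
  d i := (R.d i).hom
  aug := R.aug
  P := (R.F (q + 1)).obj
  dTop := (R.d q).hom
  inc := GrMod.kerι (R.d q).hom
  exact :=
    { aug_surjective := R.aug_surjective
      exact_E := fun i _ => R.exact i
      exact_top := R.exact q
      exact_P := fun _ y => ⟨fun hy => ⟨⟨y, hy⟩, rfl⟩, fun ⟨b, hb⟩ => hb ▸ b.2⟩
      inc_injective := fun _ => Subtype.val_injective }

end FreeResolution

/-- `ξ = f ∪ γ`, for `f : M ⟶ M'` and `γ ∈ HML^{s,t}_{n-sp}(Λ)` with `s = q + 2`. One chooses a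
resolution of `M` by objects of `F(Λ, n)` and a normalized cocycle `c` representing `γ`. Then
`λ_0[t] ∘ c(λ_1, …, λ_s)` factors as `τ ∘ λ_s` with `τ : ker λ_{s-1} → M[t]`, and `f ∪ γ` is
`(-1)^{n(n+1)/2} (f[t] ∘ τ)_* Ψ`, where `Ψ` is the class of
`0 → ker λ_{s-1} → M_{s-1} → ⋯ → M_0 → M → 0`. -/
def IsCupProduct (n : ℕ) {q : ℕ} {t : ℤ} {M M' : GrMod Λ} (f : M ⟶ M')
    (γ : HML Λ n (q + 2) t) (ξ : YExt q M ((GrMod.shift t).obj M')) : Prop :=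
  ∃ (R : FreeResolution n M) (c : Cochain (homBimodule Λ n t) (q + 2)),
    NormalizedRep c γ ∧
    ∃ τ : GrMod.ker (R.d q).hom ⟶ (GrMod.shift t).obj M,
      (∀ (k : ℤ) (x : (R.F (q + 2)).obj.carrier k) (z : (GrMod.ker (R.d q).hom).carrier k),
        (GrMod.kerι (R.d q).hom).app k z = (R.d (q + 1)).hom.app k x →
        τ.app k z = (R.eval c ≫ (GrMod.shift t).map R.aug).app k x) ∧
      ξ = ((R.truncation q).push
        (((-1 : ℤ) ^ (n * (n + 1) / 2)) • (τ ≫ (GrMod.shift t).map f))).toExt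

end MacLane

/-! ## Triangulated categories -/

section Triangulated

variable {C : Type u} [Category.{v} C] [HasShift C ℤ]

/-- Composition `T(N[i], X) × T(N[j], N) → T(N[k], X)` for `i + j = k`, sending `(x, a)` to
`N[k] ≅ N[j][i] --a[i]--> N[i] --x--> X`. -/
def shiftedComp {N X : C} {i j k : ℤ} (h : i + j = k) (x : N⟦i⟧ ⟶ X) (a : N⟦j⟧ ⟶ N) :
    N⟦k⟧ ⟶ X :=
  (shiftFunctorAdd' C j i k (by omega)).hom.app N ≫ a⟦i⟧' ≫ x

theorem shiftedComp_one {N X : C} {i : ℤ} (x : N⟦i⟧ ⟶ X) :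
    shiftedComp (add_zero i) x ((shiftFunctorZero C ℤ).hom.app N) = x := by
  unfold shiftedComp
  rw [shiftFunctorAdd'_zero_add_hom_app, ← Functor.map_comp_assoc]
  simp

theorem one_shiftedComp {N : C} {i : ℤ} (a : N⟦i⟧ ⟶ N) :
    shiftedComp (zero_add i) ((shiftFunctorZero C ℤ).hom.app N) a = a := by
  unfold shiftedComp
  rw [shiftFunctorAdd'_add_zero_hom_app]
  have := (shiftFunctorZero C ℤ).hom.naturality a
  simp only [Functor.id_map] at this
  rw [this]
  simp

theorem shiftedComp_assoc {N X : C} {i j l ij jl k : ℤ} (h₁ : i + j = ij) (h₂ : ij + l = k)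
    (h₃ : j + l = jl) (h₄ : i + jl = k) (x : N⟦i⟧ ⟶ X) (a : N⟦j⟧ ⟶ N) (b : N⟦l⟧ ⟶ N) :
    shiftedComp h₂ (shiftedComp h₁ x a) b = shiftedComp h₄ x (shiftedComp h₃ a b) := by
  unfold shiftedComp
  have e := shiftFunctorAdd'_assoc_hom_app l j i jl ij k (by omega) (by omega) (by omega) N
  have nat := (shiftFunctorAdd' C j i ij (by omega)).hom.naturality b
  simp only [Functor.comp_map] at nat
  simp only [Functor.map_comp, Category.assoc]
  rw [reassoc_of% nat, reassoc_of% e]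

variable [Preadditive C]

/-- `N` is compact: the functor `T(N, -)` to abelian groups preserves arbitrary coproducts. -/
def IsCompactObj (N : C) : Prop :=
  ∀ J : Type v, PreservesColimitsOfShape (Discrete J) (preadditiveCoyoneda.obj (op N))

theorem add_shiftedComp {N X : C} {i j k : ℤ} (h : i + j = k) (x x' : N⟦i⟧ ⟶ X)
    (a : N⟦j⟧ ⟶ N) : shiftedComp h (x + x') a = shiftedComp h x a + shiftedComp h x' a := by
  simp [shiftedComp]

variable [∀ n : ℤ, (shiftFunctor C n).Additive]

theorem shiftedComp_add {N X : C} {i j k : ℤ} (h : i + j = k) (x : N⟦i⟧ ⟶ X)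
    (a a' : N⟦j⟧ ⟶ N) : shiftedComp h x (a + a') = shiftedComp h x a + shiftedComp h x a' := by
  simp [shiftedComp, Functor.map_add]

/-- The graded endomorphism ring `Λ = T(N, N)_*`, with `Λ_k = T(N[k], N)`. -/
def endRing (N : C) : GrRing.{v} where
  carrier k := N⟦k⟧ ⟶ N
  one := (shiftFunctorZero C ℤ).hom.app N
  mul h a b := shiftedComp h a b
  add_mul h a a' b := add_shiftedComp h a a' b
  mul_add h a b b' := shiftedComp_add h a b b'
  one_mul a := one_shiftedComp a
  mul_one a := shiftedComp_one a
  mul_assoc h₁ h₂ h₃ h₄ a b c := shiftedComp_assoc h₁ h₂ h₃ h₄ a b c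

/-- The functor `X ↦ T(N, X)_*` to graded right `Λ`-modules, with `T(N, X)_k = T(N[k], X)`. -/
def gradedHom (N : C) : C ⥤ GrMod (endRing N) where
  obj X :=
    { carrier := fun k => N⟦k⟧ ⟶ X
      smul := fun h x a => shiftedComp h x a
      add_smul := fun h x x' a => add_shiftedComp h x x' a
      smul_add := fun h x a a' => shiftedComp_add h x a a'
      smul_one := fun x => shiftedComp_one x
      smul_assoc := fun h₁ h₂ h₃ h₄ x a b => shiftedComp_assoc h₁ h₂ h₃ h₄ x a b }
  map {X Y} g :=
    { app := fun k => Preadditive.rightComp (N⟦k⟧) g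
      map_smul := fun {i j k} h x a => by
        change shiftedComp h (show N⟦i⟧ ⟶ X from x) (show N⟦j⟧ ⟶ N from a) ≫ g =
          shiftedComp h ((show N⟦i⟧ ⟶ X from x) ≫ g) a
        simp [shiftedComp] }
  map_id X := by
    apply GrMod.hom_ext
    intro k x
    exact Category.comp_id (show N⟦k⟧ ⟶ X from x)
  map_comp {X Y Z} f g := by
    apply GrMod.hom_ext
    intro k x
    exact (Category.assoc (show N⟦k⟧ ⟶ X from x) f g).symm


/-- `X` is `N`-free: a (possibly infinite) coproduct of shifted copies of `N`. -/
def IsNFree (N X : C) : Prop :=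
  ∃ (I : Type v) (d : I → ℤ) (inj : ∀ i, N⟦d i⟧ ⟶ X), Nonempty (IsColimit (Cofan.mk X inj))

/-- The objects of `F_T(N, n)`: finite sums of copies of `N` shifted by multiples of `n`. -/
def IsFinNFree (n : ℕ) (N X : C) : Prop :=
  ∃ (m : ℕ) (d : Fin m → ℤ) (inj : ∀ i, N⟦d i⟧ ⟶ X),
    (∀ i, (n : ℤ) ∣ d i) ∧ Nonempty (IsColimit (Cofan.mk X inj))

variable [HasZeroObject C] [Pretriangulated C]

/-- An `m`-filtered object in `{λ_1, …, λ_{m-1}}`, for maps `lam j = λ_{j+1} : X_{j+1} ⟶ X_j`: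
maps `0 = F_0 ⟶ F_1 ⟶ ⋯ ⟶ F_m` and distinguished triangles
`F_j --i j--> F_{j+1} --p j--> X_j[j] --d j--> F_j[1]` for `j < m`, such that the composite
`X_j[j] --d j--> F_j[1] ⟶ X_{j-1}[j-1][1]` is `λ_j[j]` for `1 ≤ j < m`. The data with larger
indices plays no role. -/
structure FilteredObject (X : ℕ → C) (lam : ∀ j, X (j + 1) ⟶ X j) (m : ℕ) where
  F : ℕ → C
  i : ∀ j, F j ⟶ F (j + 1)
  p : ∀ j : ℕ, F (j + 1) ⟶ (X j)⟦(j : ℤ)⟧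
  d : ∀ j : ℕ, (X j)⟦(j : ℤ)⟧ ⟶ (F j)⟦(1 : ℤ)⟧
  isZero : IsZero (F 0)
  distinguished : ∀ j, j < m → Triangle.mk (i j) (p j) (d j) ∈ distTriang C
  comm : ∀ j, j + 1 < m →
    d (j + 1) ≫ (p j)⟦(1 : ℤ)⟧' =
      (lam j)⟦((j + 1 : ℕ) : ℤ)⟧' ≫
        (shiftFunctorAdd' C (j : ℤ) 1 ((j + 1 : ℕ) : ℤ) (by push_cast; rfl)).hom.app (X j)

namespace FilteredObject

variable {X : ℕ → C} {lam : ∀ j, X (j + 1) ⟶ X j} {m : ℕ}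

theorem isIso_p_zero (Z : FilteredObject X lam (m + 1)) : IsIso (Z.p 0) :=
  (Triangle.isZero₁_iff_isIso₂ _ (Z.distinguished 0 (Nat.succ_pos m))).1 Z.isZero

/-- The composite `F_1 ⟶ ⋯ ⟶ F_{j+1}`. -/
def incl (Z : FilteredObject X lam m) : ∀ j : ℕ, Z.F 1 ⟶ Z.F (j + 1)
  | 0 => 𝟙 _
  | j + 1 => Z.incl j ≫ Z.i (j + 1)

/-- The map `σ' : X_0 ≅ F_1 ⟶ F_m`. -/
noncomputable def sigma' (Z : FilteredObject X lam (m + 1)) : X 0 ⟶ Z.F (m + 1) :=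
  haveI := Z.isIso_p_zero
  (shiftFunctorZero C ℤ).inv.app (X 0) ≫ inv (Z.p 0) ≫ Z.incl m

/-- The map `σ : F_m ⟶ X_{m-1}[m-1]`. -/
def sigma (Z : FilteredObject X lam (m + 1)) : Z.F (m + 1) ⟶ (X m)⟦(m : ℤ)⟧ := Z.p m

end FilteredObject

/-- The `(m + 2)`-fold Toda bracket `⟨λ_1, …, λ_{m+2}⟩ ⊆ T(X_{m+2}[m], X_0)`, with
`lam j = λ_{j+1} : X_{j+1} ⟶ X_j`. -/
def TodaBracket (X : ℕ → C) (lam : ∀ j, X (j + 1) ⟶ X j) (m : ℕ) :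
    Set ((X (m + 2))⟦(m : ℤ)⟧ ⟶ X 0) :=
  {g | ∃ (Z : FilteredObject (fun j => X (j + 1)) (fun j => lam (j + 1)) (m + 1))
      (g₀ : Z.F (m + 1) ⟶ X 0) (g₁ : (X (m + 2))⟦(m : ℤ)⟧ ⟶ Z.F (m + 1)),
      Z.sigma' ≫ g₀ = lam 0 ∧ g₁ ≫ Z.sigma = (lam (m + 1))⟦(m : ℤ)⟧' ∧ g = g₁ ≫ g₀}

/-- The Toda bracket `⟨λ'_1, …, λ'_{m+2}⟩` of maps `lam' j = λ'_{j+1} : M_{j+1} ⟶ M_j` in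
`F(Λ, n)`, `Λ = T(N, N)_*`, as a set of maps `M_{m+2} ⟶ M_0[-m]`: one lifts the `M_j` and the
`λ'_j` along the equivalence `T(N, -)_* : F_T(N, n) ≌ F(Λ, n)`, and lets an element
`g : X_{m+2}[m] ⟶ X_0` of the Toda bracket of the lifts act by
`T(N[k], X_{m+2}) → T(N[k + m], X_0)`, `x ↦ g ∘ x[m]`. -/
def ModTodaBracket (n : ℕ) (N : C) (M : ℕ → FreeCat (endRing N) n)
    (lam' : ∀ j, M (j + 1) ⟶ M j) (m : ℕ) :
    Set ((M (m + 2)).obj ⟶ (GrMod.shift (-(m : ℤ))).obj (M 0).obj) :=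
  {g' | ∃ (X : ℕ → C) (_ : ∀ j, IsFinNFree n N (X j)) (lam : ∀ j, X (j + 1) ⟶ X j)
      (e : ∀ j, (gradedHom N).obj (X j) ≅ (M j).obj)
      (_ : ∀ j, (gradedHom N).map (lam j) ≫ (e j).hom = (e (j + 1)).hom ≫ (lam' j).hom)
      (g : (X (m + 2))⟦(m : ℤ)⟧ ⟶ X 0) (_ : g ∈ TodaBracket X lam m),
      ∀ (k : ℤ) (x : N⟦k⟧ ⟶ X (m + 2)),
        g'.app k ((e (m + 2)).hom.app k x) =
          (e 0).hom.app (k - -(m : ℤ))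
            ((shiftFunctorAdd' C k (m : ℤ) (k - -(m : ℤ)) (by omega)).hom.app N ≫
              x⟦(m : ℤ)⟧' ≫ g)}

/-- An `N`-exact `k`-Postnikov system for `M`: objects `X_0, …, X_k`, `Y_0 ≅ X_0`, `Y_1, …,
Y_{k-1}`, maps `π_j : Y_j ⟶ X_j`, `ι_{j+1} : X_{j+1} ⟶ Y_j` (written `iota j`) and
`α_{j+1} : Y_j ⟶ Y_{j+1}[1]` (written `alpha j`), with distinguished triangles
`Y_{j+1} --π--> X_{j+1} --ι--> Y_j --α--> Y_{j+1}[1]` for `j + 1 < k`. The maps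
`d_{j+1} = π_j ι_{j+1} : X_{j+1} ⟶ X_j` and the augmentation induce an exact sequence
`T(N, X_k)_* → ⋯ → T(N, X_0)_* → M → 0`. The data with larger indices plays no role. -/
structure PostnikovSystem (N : C) (M : GrMod (endRing N)) (k : ℕ) where
  X : ℕ → C
  Y : ℕ → C
  pi : ∀ j, Y j ⟶ X j
  iota : ∀ j, X (j + 1) ⟶ Y j
  alpha : ∀ j, Y j ⟶ (Y (j + 1))⟦(1 : ℤ)⟧
  isIso_pi_zero : IsIso (pi 0)
  distinguished : ∀ j, j + 1 < k → Triangle.mk (pi (j + 1)) (iota j) (alpha j) ∈ distTriang C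
  free : ∀ j, j ≤ k → IsNFree N (X j)
  aug : (gradedHom N).obj (X 0) ⟶ M
  aug_surjective : ∀ i, Function.Surjective (aug.app i)
  exact : ∀ j, j < k → ∀ (i : ℤ) (x : ((gradedHom N).obj (X j)).carrier i),
    GrMod.IsCycle (fun j => (gradedHom N).obj (X j))
      (fun j => (gradedHom N).map (iota j ≫ pi j)) aug j x ↔
        ∃ y, ((gradedHom N).map (iota j ≫ pi j)).app i y = x

namespace PostnikovSystem

variable {N : C} {M : GrMod (endRing N)} {k : ℕ}

/-- The composite `α_j ⋯ α_1 : Y_0 ⟶ Y_j[j]`. -/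
def alphaComp (S : PostnikovSystem N M k) : ∀ j : ℕ, S.Y 0 ⟶ (S.Y j)⟦(j : ℤ)⟧
  | 0 => (shiftFunctorZero C ℤ).inv.app (S.Y 0)
  | j + 1 => S.alphaComp j ≫ (S.alpha j)⟦(j : ℤ)⟧' ≫
      (shiftFunctorAdd' C (1 : ℤ) (j : ℤ) ((j + 1 : ℕ) : ℤ) (by push_cast; ring)).inv.app _

end PostnikovSystem

namespace PostnikovSystem

variable {N : C} {M : GrMod (endRing N)} {n : ℕ} (S : PostnikovSystem N M (n + 1))

/-- The sequence
`M[-n] --η--> T(N, Y_n)_* --π_n--> T(N, X_n)_* --d_n--> ⋯ --d_1--> T(N, X_0)_* → M`. -/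
def seq (η : (GrMod.shift (-(n : ℤ))).obj M ⟶ (gradedHom N).obj (S.Y n)) :
    YSeq n M ((GrMod.shift (-(n : ℤ))).obj M) where
  E j := (gradedHom N).obj (S.X j)
  d j := (gradedHom N).map (S.iota j ≫ S.pi j)
  aug := S.aug
  P := (gradedHom N).obj (S.Y n)
  dTop := (gradedHom N).map (S.pi n)
  inc := η

/-- `η : M[-n] ⟶ T(N, Y_n)_*` is induced by `α_n ⋯ α_1 : X_0 = Y_0 ⟶ Y_n[n]`: it sends the class in
`M` of `y : N[i + n] ⟶ Y_0` to the map `z : N[i] ⟶ Y_n` with `z[n] = α_n ⋯ α_1 y`. -/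
def IsInduced (η : (GrMod.shift (-(n : ℤ))).obj M ⟶ (gradedHom N).obj (S.Y n)) : Prop :=
  ∀ (i : ℤ) (y : N⟦i - -(n : ℤ)⟧ ⟶ S.Y 0) (z : N⟦i⟧ ⟶ S.Y n),
    η.app i (S.aug.app (i - -(n : ℤ)) (y ≫ S.pi 0)) = z →
      (shiftFunctorAdd' C i (n : ℤ) (i - -(n : ℤ)) (by omega)).hom.app N ≫ z⟦(n : ℤ)⟧' =
        y ≫ S.alphaComp n

/-- `ξ` is the obstruction class `κ_{n+2}(M) ∈ Ext^{n+2,-n}(M, M)` of the `(n + 1)`-Postnikov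
system: the Yoneda class of the exact sequence
`0 → M[-n] → T(N, Y_n)_* → T(N, X_n)_* → ⋯ → T(N, X_0)_* → M → 0`. -/
def IsObstructionClass (ξ : YExt n M ((GrMod.shift (-(n : ℤ))).obj M)) : Prop :=
  ∃ (η : (GrMod.shift (-(n : ℤ))).obj M ⟶ (gradedHom N).obj (S.Y n)) (_ : S.IsInduced η)
    (h : (S.seq η).IsExact), ξ = (YExtension.mk (S.seq η) h).toExt

end PostnikovSystem

end Triangulated

/-! Both classes are computed from a single Postnikov system built out of the Toda bracket. An
element of the bracket is `g₁ ≫ g₀` for a filtered object with stages `F_j`, where `g₀` extends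
`λ_1` and `g₁` lifts `λ_{n+2}[n]`. By the octahedral axiom the cones `W_j` of the restrictions of
`g₀` to `F_j` form a tower under `X_0` with triangles `X_{j+1}[j] ⟶ W_j ⟶ W_{j+1}`. Desuspending
`W_j` by `j` gives objects `Y_j` whose differentials are `(-1)^j λ_{j+1}`
(`FilteredObject.exists_tower`), hence an `N`-exact Postnikov system (`ofResolution`).

In this system `ι_{n+1} : X_{n+1} ⟶ Y_n` sends `ker λ_{n+1}` into `ker π_n`, which is the image of
`η`; this defines `τ`. The relation between `ι_{n+1}` and `α_n ⋯ α_1` shows that `τ λ_{n+2}` is the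
augmented bracket element, as the cup product requires. The resolution therefore maps to the
obstruction extension with `τ` on the left end. Absorbing the signs `(-1)^j` rescales degree `i` by
`(-1)^{i(i-1)/2}`, and in degree `n + 1` this is the sign `(-1)^{n(n+1)/2}` of the cup product
(`isCupProduct_iff`).

Two independence statements remain. For the obstruction class, `ker π_j` on `T(N, Y_j)_*` is `M[-j]`
(`isImage_aux`). Since `M` is `n`-sparse, this kernel vanishes in degrees divisible by `n` when `0 <
j < n`, so the constructed system maps to every other one (`nonempty_map`). For the cup product, a
prism argument compares two resolutions and an inclusion-exclusion argument compares two
cohomologous normalized cocycles (`eval_comparison`). The discrepancies either die under the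
augmentation or extend over `M_{n+1}`, so the pushout extension is unchanged. -/

section Yoneda

/-! ### Graded modules: projectivity, pushouts of extensions, comparison of resolutions. -/

namespace GrMod

variable {Λ : GrRing.{v}}

theorem add_app {M N : GrMod Λ} (f g : M ⟶ N) (k : ℤ) (x : M.carrier k) :
    (f + g).app k x = f.app k x + g.app k x := rfl

/-- The map out of a pushout given by maps that agree on the common source. -/
def pushoutLift {B B' P E : GrMod Λ} (f : B ⟶ B') (g : B ⟶ P) (u : B' ⟶ E) (w : P ⟶ E)
    (h : f ≫ u = g ≫ w) : pushout f g ⟶ E where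
  app k := QuotientAddGroup.lift (pushoutRel f g k) ((u.app k).coprod (w.app k)) (by
    rintro _ ⟨b, rfl⟩
    change u.app k (f.app k b) + w.app k (-(g.app k b)) = 0
    have := congrArg (fun φ : B ⟶ E => φ.app k b) h
    simp only [comp_app] at this
    rw [this, map_neg, add_neg_cancel])
  map_smul {i j k} h x a := by
    induction x using QuotientAddGroup.induction_on with
    | H x =>
      change u.app k (B'.smul h x.1 a) + w.app k (P.smul h x.2 a) =
        E.smul h (u.app i x.1 + w.app i x.2) a
      rw [u.map_smul, w.map_smul, E.add_smul]

/-- Finitely generated free modules are projective: a map lifts along `ψ` as soon as its values are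
in the image of `ψ`. -/
theorem IsFinFree.exists_lift {F B P : GrMod Λ} (hF : F.IsFinFree) (φ : F ⟶ B) (ψ : P ⟶ B)
    (h : ∀ k x, ∃ y, ψ.app k y = φ.app k x) : ∃ f : F ⟶ P, f ≫ ψ = φ := by
  obtain ⟨m, d, e, he⟩ := hF
  choose y hy using fun i => h (d i) (e i)
  let E : ∀ k, (∀ i, Λ.carrier (k - d i)) ≃+ F.carrier k := fun k =>
    { Equiv.ofBijective _ (he k) with
      map_add' := fun a b => by
        change ∑ i, F.smul (add_sub_cancel (d i) k) (e i) (a i + b i) =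
          ∑ i, F.smul (add_sub_cancel (d i) k) (e i) (a i) +
            ∑ i, F.smul (add_sub_cancel (d i) k) (e i) (b i)
        simp only [F.smul_add, Finset.sum_add_distrib] }
  have hE : ∀ k a, E k a = ∑ i, F.smul (add_sub_cancel (d i) k) (e i) (a i) := fun k a => rfl
  let L : ∀ k, (∀ i, Λ.carrier (k - d i)) →+ P.carrier k := fun k =>
    { toFun := fun a => ∑ i, P.smul (add_sub_cancel (d i) k) (y i) (a i)
      map_zero' := by
        refine Finset.sum_eq_zero fun i _ => ?_
        have := P.smul_add (add_sub_cancel (d i) k) (y i) 0 0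
        simpa using this
      map_add' := fun a b => by
        simp only [Pi.add_apply, P.smul_add, Finset.sum_add_distrib] }
  have hL : ∀ k a, L k a = ∑ i, P.smul (add_sub_cancel (d i) k) (y i) (a i) := fun k a => rfl
  have smulsum : ∀ (Q : GrMod Λ) {i j k : ℤ} (h : i + j = k) (z : Fin m → Q.carrier i)
      (b : Λ.carrier j), Q.smul h (∑ l, z l) b = ∑ l, Q.smul h (z l) b := fun Q i j k h z b =>
    map_sum (Q.smulHom h b) z _
  refine ⟨{ app := fun k => (L k).comp (E k).symm.toAddMonoidHom, map_smul := ?_ }, ?_⟩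
  · intro i j k h x b
    obtain ⟨a, rfl⟩ := (E i).surjective x
    change L k ((E k).symm (F.smul h (E i a) b)) = P.smul h (L i ((E i).symm (E i a))) b
    have key : F.smul h (E i a) b = E k fun l => Λ.mul (by omega) (a l) b := by
      rw [hE, hE, smulsum]
      exact Finset.sum_congr rfl fun l _ => F.smul_assoc _ _ _ _ _ _ _
    rw [key, AddEquiv.symm_apply_apply, AddEquiv.symm_apply_apply, hL, hL, smulsum]
    exact Finset.sum_congr rfl fun l _ => (P.smul_assoc _ _ _ _ _ _ _).symm
  · ext k x
    obtain ⟨a, rfl⟩ := (E k).surjective x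
    change ψ.app k (L k ((E k).symm (E k a))) = _
    rw [AddEquiv.symm_apply_apply, hL, hE, map_sum, map_sum]
    refine Finset.sum_congr rfl fun i _ => ?_
    rw [ψ.map_smul, φ.map_smul, hy]

end GrMod

variable {Λ : GrRing.{v}}

/-- A morphism of extensions that is the identity on the right end and `τ` on the left end
identifies its target with the pushout of its source. -/
theorem YExtension.push_toExt {q : ℕ} {A B B' : GrMod Λ} (T : YExtension q A B)
    (S : YExtension q A B') (τ : B ⟶ B') (f : ∀ i, i ≤ q → (T.E i ⟶ S.E i)) (fP : T.P ⟶ S.P)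
    (comm_aug : f 0 (Nat.zero_le q) ≫ S.aug = T.aug)
    (comm_d : ∀ i (h : i + 1 ≤ q), f (i + 1) h ≫ S.d i = T.d i ≫ f i (Nat.le_of_succ_le h))
    (comm_top : fP ≫ S.dTop = T.dTop ≫ f q le_rfl) (comm_inc : T.inc ≫ fP = τ ≫ S.inc) :
    (T.push τ).toExt = S.toExt := by
  refine Quot.sound ⟨
    { f := f
      fP := GrMod.pushoutLift _ _ S.inc fP comm_inc.symm
      comm_aug := comm_aug
      comm_d := comm_d
      comm_top := ?_
      comm_inc := ?_ }⟩
  · ext k x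
    induction x using QuotientAddGroup.induction_on with
    | H x =>
      change S.dTop.app k (S.inc.app k x.1 + fP.app k x.2) = (f q le_rfl).app k (T.dTop.app k x.2)
      rw [map_add, (S.exact.exact_P k _).2 ⟨x.1, rfl⟩, zero_add]
      exact congrArg (fun φ : T.P ⟶ S.E q => φ.app k x.2) comm_top
  · ext k x
    change S.inc.app k x + fP.app k 0 = _
    rw [map_zero, add_zero]

/-- Dependent choice, used to build chain maps and morphisms of Postnikov systems one term at a
time. -/
theorem exists_seq_of_forall_exists {A : ℕ → Type*} (r : ∀ j, A j → A (j + 1) → Prop) (a : A 0)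
    (h : ∀ j x, ∃ y, r j x y) : ∃ s : ∀ j, A j, s 0 = a ∧ ∀ j, r j (s j) (s (j + 1)) := by
  choose g hg using h
  exact ⟨fun j => Nat.rec a (fun j x => g j x) j, rfl, fun j => hg j _⟩

namespace FreeResolution

variable {n : ℕ} {M : GrMod Λ}

/-- The comparison map between two free resolutions. -/
theorem exists_comparison (R R' : FreeResolution n M) :
    ∃ f : ∀ i, R.F i ⟶ R'.F i, (f 0).hom ≫ R'.aug = R.aug ∧
      ∀ i, f (i + 1) ≫ R'.d i = R.d i ≫ f i := by
  -- The invariant of the recursion is that cycles go to cycles; this is all that lifting the next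
  -- term needs.
  let A : ℕ → Type v := fun i => { f : R.F i ⟶ R'.F i //
    ∀ (k : ℤ) (x : (R.F i).obj.carrier k),
      GrMod.IsCycle (fun i => (R.F i).obj) (fun i => (R.d i).hom) R.aug i x →
      GrMod.IsCycle (fun i => (R'.F i).obj) (fun i => (R'.d i).hom) R'.aug i (f.hom.app k x) }
  obtain ⟨f₀, h₀⟩ := (R.F 0).property.1.exists_lift R.aug R'.aug
    (fun k x => R'.aug_surjective k _)
  let a₀ : A 0 := ⟨⟨f₀⟩, fun k x hx => by
    change R'.aug.app k (f₀.app k x) = 0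
    rw [← GrMod.comp_app, h₀]
    exact hx⟩
  obtain ⟨s, hs₀, hs⟩ := exists_seq_of_forall_exists (A := A)
    (fun i a b => b.1 ≫ R'.d i = R.d i ≫ a.1) a₀ (by
      intro i a
      obtain ⟨g, hg⟩ := (R.F (i + 1)).property.1.exists_lift ((R.d i).hom ≫ a.1.hom) (R'.d i).hom
        (fun k x => (R'.exact i k _).1 (a.2 k _ ((R.exact i k _).2 ⟨x, rfl⟩)))
      refine ⟨⟨⟨g⟩, fun k x hx => ?_⟩, ObjectProperty.hom_ext _ hg⟩
      change (R'.d i).hom.app k (g.app k x) = 0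
      rw [← GrMod.comp_app, hg, GrMod.comp_app]
      change (R.d i).hom.app k x = 0 at hx
      rw [hx, map_zero])
  refine ⟨fun i => (s i).1, ?_, hs⟩
  change (s 0).1.hom ≫ R'.aug = R.aug
  rw [hs₀]
  exact h₀

theorem d_comp_d (R : FreeResolution n M) (i : ℕ) : R.d (i + 1) ≫ R.d i = 0 := by
  apply ObjectProperty.hom_ext
  ext k x
  exact (R.exact (i + 1) k _).2 ⟨x, rfl⟩

theorem d_comp_aug (R : FreeResolution n M) : (R.d 0).hom ≫ R.aug = 0 := by
  ext k x
  exact (R.exact 0 k _).2 ⟨x, rfl⟩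

end FreeResolution

end Yoneda

/-! ### Cochains on complexes: normalized coboundaries contribute only outer terms. -/

section BW

variable {C : Type u} [Category.{v} C]

namespace Cochain

variable {D : Cᵒᵖ ⥤ C ⥤ AddCommGrpCat.{v}}

/-- The map `D(X_s, X_0) → D(X, Y)` induced by maps `X ⟶ X_s` and `X_0 ⟶ Y`. -/
def transport (D : Cᵒᵖ ⥤ C ⥤ AddCommGrpCat.{v}) {m : ℕ} (F : Chain C m) {X Y : Cᵒᵖ}
    (β : F.obj (Fin.last m) ⟶ X) (α : Y ⟶ F.obj 0) :
    (D.obj (F.obj (Fin.last m))).obj (F.obj 0).unop ⟶ (D.obj X).obj Y.unop :=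
  (D.map β).app _ ≫ (D.obj X).map α.unop

theorem map_app_comp_map (D : Cᵒᵖ ⥤ C ⥤ AddCommGrpCat.{v}) {A B X Y P P' : Cᵒᵖ} (a : A ⟶ B)
    (β : B ⟶ X) (α : Y ⟶ P) (γ : P ⟶ P') :
    ((D.map a).app P'.unop ≫ (D.obj B).map γ.unop) ≫ (D.map β).app P.unop ≫
      (D.obj X).map α.unop = (D.map (a ≫ β)).app P'.unop ≫ (D.obj X).map (α ≫ γ).unop := by
  rw [unop_comp, Functor.map_comp, Functor.map_comp, NatTrans.comp_app, Category.assoc,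
    Category.assoc, (D.map β).naturality_assoc]

theorem faceValue_comp_transport {m : ℕ} (F : Chain C (m + 1)) {X Y : Cᵒᵖ}
    (β : F.obj (Fin.last (m + 1)) ⟶ X) (α : Y ⟶ F.obj 0) (i : Fin (m + 2)) :
    faceValue D i F ≫ transport D F β α = transport D (F.face i)
      (F.map (homOfLE (Fin.le_last (i.succAbove (Fin.last m)))) ≫ β)
      (α ≫ F.map (homOfLE (Fin.zero_le (i.succAbove 0)))) :=
  map_app_comp_map D _ _ _ _

/-- The value of a cochain, transported to `D(X, Y)`. -/
def value {m : ℕ} (c : Cochain D m) (F : Chain C m) {X Y : Cᵒᵖ} (β : F.obj (Fin.last m) ⟶ X)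
    (α : Y ⟶ F.obj 0) : (D.obj X).obj Y.unop :=
  transport D F β α (c F)

theorem value_coboundary {m : ℕ} (c : Cochain D m) (F : Chain C (m + 1)) {X Y : Cᵒᵖ}
    (β : F.obj (Fin.last (m + 1)) ⟶ X) (α : Y ⟶ F.obj 0) :
    value (coboundary D m c) F β α = ∑ i : Fin (m + 2), ((-1 : ℤ) ^ (i : ℕ)) •
      value c (F.face i) (F.map (homOfLE (Fin.le_last (i.succAbove (Fin.last m)))) ≫ β)
        (α ≫ F.map (homOfLE (Fin.zero_le (i.succAbove 0)))) := by
  change transport D F β α (∑ i : Fin (m + 2), ((-1 : ℤ) ^ (i : ℕ)) •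
    (faceValue D i F) (c (F.face i))) = _
  rw [map_sum]
  refine Finset.sum_congr rfl fun i _ => ?_
  rw [map_zsmul]
  congr 1
  exact congrArg (fun φ => φ.hom (c (F.face i))) (faceValue_comp_transport F β α i)

theorem value_eq_zero [HasZeroMorphisms C] {m : ℕ} {c : Cochain D m} (hc : IsNormalized c)
    (F : Chain C m) {X Y : Cᵒᵖ} (β : F.obj (Fin.last m) ⟶ X) (α : Y ⟶ F.obj 0) (i : Fin m)
    (hi : (F.map (homOfLE i.castSucc_le_succ)).unop = 0) : value c F β α = 0 := by
  unfold value
  rw [hc _ ⟨i, hi⟩, map_zero]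

theorem value_id {m : ℕ} (c : Cochain D m) (F : Chain C m) : value c F (𝟙 _) (𝟙 _) = c F := by
  unfold value transport
  simp

/-- The transport maps start or end at objects of two chains that are only propositionally equal,
hence the heterogeneous equalities. -/
theorem value_congr {m : ℕ} (c : Cochain D m) {F F' : Chain C m} (h : F = F') {X Y : Cᵒᵖ}
    {β : F.obj (Fin.last m) ⟶ X} {α : Y ⟶ F.obj 0} {β' : F'.obj (Fin.last m) ⟶ X}
    {α' : Y ⟶ F'.obj 0} (hβ : HEq β β') (hα : HEq α α') : value c F β α = value c F' β' α' := by
  subst h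
  rw [eq_of_heq hβ, eq_of_heq hα]

/-- The elements of `D(X, Y)` of the form `p_* u + r^* w`. -/
def outer (D : Cᵒᵖ ⥤ C ⥤ AddCommGrpCat.{v}) {X X₁ Y Y₁ : Cᵒᵖ} (r : X₁ ⟶ X) (p : Y ⟶ Y₁) :
    AddSubgroup ((D.obj X).obj Y.unop) :=
  ((D.obj X).map p.unop).hom.range ⊔ ((D.map r).app Y.unop).hom.range

theorem value_mem_outer_left {m : ℕ} (c : Cochain D m) (F : Chain C m) {X X₁ Y Y₁ : Cᵒᵖ}
    (r : X₁ ⟶ X) (p : Y ⟶ Y₁) (β : F.obj (Fin.last m) ⟶ X) {α' : Y ⟶ F.obj 0} (α : Y₁ ⟶ F.obj 0)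
    (h : α' = p ≫ α) : value c F β α' ∈ outer D r p := by
  subst h
  refine AddSubgroup.mem_sup_left ⟨value c F β α, ?_⟩
  have : transport D F β α ≫ (D.obj X).map p.unop = transport D F β (p ≫ α) := by
    unfold transport
    rw [unop_comp, Functor.map_comp, Category.assoc]
  exact congrArg (fun φ => φ.hom (c F)) this

theorem value_mem_outer_right {m : ℕ} (c : Cochain D m) (F : Chain C m) {X X₁ Y Y₁ : Cᵒᵖ}
    (r : X₁ ⟶ X) (p : Y ⟶ Y₁) {β' : F.obj (Fin.last m) ⟶ X} (β : F.obj (Fin.last m) ⟶ X₁)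
    (α : Y ⟶ F.obj 0) (h : β' = β ≫ r) : value c F β' α ∈ outer D r p := by
  subst h
  refine AddSubgroup.mem_sup_right ⟨value c F β α, ?_⟩
  have : transport D F β α ≫ (D.map r).app Y.unop = transport D F (β ≫ r) α := by
    unfold transport
    rw [Functor.map_comp, NatTrans.comp_app, Category.assoc, Category.assoc,
      (D.map r).naturality]
  exact congrArg (fun φ => φ.hom (c F)) this

variable {Q : Type} [Preorder Q]

/-- The value of a cochain on the simplex `σ` of a poset-shaped diagram `G` with extreme elements
`o` and `t`, transported to `D(G t, G o)`. -/
def along {m : ℕ} (c : Cochain D m) (G : Q ⥤ Cᵒᵖ) {o t : Q} (ho : ∀ q, o ≤ q) (ht : ∀ q, q ≤ t)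
    (σ : Fin (m + 1) →o Q) : (D.obj (G.obj t)).obj (G.obj o).unop :=
  value c (σ.monotone.functor ⋙ G) (G.map (homOfLE (ht (σ (Fin.last m)))))
    (G.map (homOfLE (ho (σ 0))))

/-- All arrows of a poset-shaped diagram between given objects agree, so transports compose and the
coboundary becomes the plain alternating sum over faces of `σ`, outer faces included. -/
theorem along_coboundary {m : ℕ} (c : Cochain D m) (G : Q ⥤ Cᵒᵖ) {o t : Q} (ho : ∀ q, o ≤ q)
    (ht : ∀ q, q ≤ t) (σ : Fin (m + 2) →o Q) :
    along (coboundary D m c) G ho ht σ = ∑ i : Fin (m + 2), ((-1 : ℤ) ^ (i : ℕ)) •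
      along c G ho ht (σ.comp (Fin.succAboveOrderEmb i).toOrderHom) := by
  refine (value_coboundary c _ _ _).trans (Finset.sum_congr rfl fun i _ => ?_)
  congr 1
  have h₁ := (G.map_comp (homOfLE (σ.monotone (Fin.le_last (i.succAbove (Fin.last m)))))
    (homOfLE (ht (σ (Fin.last (m + 1)))))).symm
  have h₂ := (G.map_comp (homOfLE (ho (σ 0)))
    (homOfLE (σ.monotone (Fin.zero_le (i.succAbove 0))))).symm
  exact congrArg₂ (value c ((σ.comp (Fin.succAboveOrderEmb i).toOrderHom).monotone.functor ⋙ G))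
    h₁ h₂

theorem along_eq_zero [HasZeroMorphisms C] {m : ℕ} {c : Cochain D m} (hc : IsNormalized c)
    (G : Q ⥤ Cᵒᵖ) {o t : Q} (ho : ∀ q, o ≤ q) (ht : ∀ q, q ≤ t) (σ : Fin (m + 1) →o Q) (i : Fin m)
    (hi : (G.map (homOfLE (σ.monotone i.castSucc_le_succ))).unop = 0) :
    along c G ho ht σ = 0 :=
  value_eq_zero hc _ _ _ i hi

end Cochain

/-- The chain obtained from `F` by replacing the maps with index in `T` by zero. -/
def Chain.cut [HasZeroMorphisms C] {s : ℕ} (F : Chain C s) (T : Finset (Fin s)) : Chain C s where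
  obj := F.obj
  map {a b} f := by
    classical
    exact if ∃ i ∈ T, a ≤ i.castSucc ∧ i.castSucc < b then (0 : (F.obj b).unop ⟶ (F.obj a).unop).op
      else F.map f
  map_id a := by
    rw [if_neg, F.map_id]
    rintro ⟨i, -, h₁, h₂⟩
    exact absurd h₂ (not_lt.2 h₁)
  map_comp {a b c} f g := by
    have hab := leOfHom f
    have hbc := leOfHom g
    by_cases h₁ : ∃ i ∈ T, a ≤ i.castSucc ∧ i.castSucc < b
    · rw [if_pos h₁, if_pos (by
        obtain ⟨i, hi, h⟩ := h₁
        exact ⟨i, hi, h.1, h.2.trans_le hbc⟩)]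
      apply Quiver.Hom.unop_inj
      simp
    · by_cases h₂ : ∃ i ∈ T, b ≤ i.castSucc ∧ i.castSucc < c
      · rw [if_pos h₂, if_pos (by
          obtain ⟨i, hi, h⟩ := h₂
          exact ⟨i, hi, hab.trans h.1, h.2⟩)]
        apply Quiver.Hom.unop_inj
        simp
      · rw [if_neg h₁, if_neg h₂, if_neg, F.map_comp]
        rintro ⟨i, hi, h⟩
        rcases lt_or_ge i.castSucc b with hb | hb
        · exact h₁ ⟨i, hi, h.1, hb⟩
        · exact h₂ ⟨i, hi, hb, h.2⟩

namespace Chain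

variable [HasZeroMorphisms C] {s : ℕ}

theorem cut_map_of_mem (F : Chain C s) {T : Finset (Fin s)} {i : Fin s} (hi : i ∈ T)
    {a b : Fin (s + 1)} (f : a ⟶ b) (ha : a ≤ i.castSucc) (hb : i.castSucc < b) :
    (F.cut T).map f = (0 : (F.obj b).unop ⟶ (F.obj a).unop).op :=
  if_pos ⟨i, hi, ha, hb⟩

theorem cut_map_of_not_mem (F : Chain C s) {T : Finset (Fin s)} {a b : Fin (s + 1)} (f : a ⟶ b)
    (h : ∀ i ∈ T, a ≤ i.castSucc → b ≤ i.castSucc) : (F.cut T).map f = F.map f :=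
  if_neg fun ⟨i, hi, ha, hb⟩ => absurd (h i hi ha) (not_le.2 hb)

theorem cut_empty (F : Chain C s) : F.cut ∅ = F := by
  refine CategoryTheory.Functor.hext (fun _ => rfl) fun a b f => heq_of_eq ?_
  exact F.cut_map_of_not_mem f (by simp)

/-- The first map of the cut chain is unchanged or zero, hence divisible by the first map of `F`.
This keeps the outer faces of all cut chains in the one subgroup `outer` attached to `F`. -/
theorem cut_map_factors_left (F : Chain C (s + 1)) (T : Finset (Fin (s + 1))) :
    ∃ α : F.obj (Fin.succ 0) ⟶ F.obj (Fin.succ 0),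
      (F.cut T).map (homOfLE (Fin.zero_le (Fin.succ 0))) =
        F.map (homOfLE (Fin.zero_le (Fin.succ 0))) ≫ α := by
  by_cases h : (0 : Fin (s + 1)) ∈ T
  · refine ⟨(0 : (F.obj (Fin.succ 0)).unop ⟶ (F.obj (Fin.succ 0)).unop).op,
      (F.cut_map_of_mem h _ le_rfl Fin.castSucc_lt_succ).trans (Quiver.Hom.unop_inj ?_)⟩
    exact (zero_comp (C := C)).symm
  · refine ⟨𝟙 _, (F.cut_map_of_not_mem _ fun k hk _ => ?_).trans (Category.comp_id _).symm⟩
    rcases Fin.eq_zero_or_eq_succ k with rfl | ⟨l, rfl⟩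
    · exact absurd hk h
    · exact Fin.succ_le_castSucc_iff.2 (Fin.succ_pos l)

theorem cut_map_factors_right (F : Chain C (s + 1)) (T : Finset (Fin (s + 1))) :
    ∃ β : F.obj (Fin.last s).castSucc ⟶ F.obj (Fin.last s).castSucc,
      (F.cut T).map (homOfLE (Fin.le_last (Fin.last s).castSucc)) =
        β ≫ F.map (homOfLE (Fin.le_last (Fin.last s).castSucc)) := by
  by_cases h : Fin.last s ∈ T
  · refine ⟨(0 : (F.obj (Fin.last s).castSucc).unop ⟶ (F.obj (Fin.last s).castSucc).unop).op,
      (F.cut_map_of_mem h _ le_rfl (Fin.castSucc_lt_last _)).trans (Quiver.Hom.unop_inj ?_)⟩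
    simp
  · refine ⟨𝟙 _, (F.cut_map_of_not_mem _ fun k hk hk' => ?_).trans (Category.id_comp _).symm⟩
    rcases Fin.eq_castSucc_or_eq_last k with ⟨l, rfl⟩ | rfl
    · exact absurd hk' (not_le.2 (Fin.castSucc_lt_castSucc_iff.2 (Fin.castSucc_lt_last l)))
    · exact absurd hk h

/-- A chain is a complex if consecutive maps compose to zero. -/
def IsComplex (F : Chain C s) : Prop :=
  ∀ (a b : Fin (s + 1)) (f : a ⟶ b), (a : ℕ) + 2 ≤ b →
    F.map f = (0 : (F.obj b).unop ⟶ (F.obj a).unop).op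

theorem IsComplex.cut {F : Chain C s} (hF : F.IsComplex) (T : Finset (Fin s)) :
    (F.cut T).IsComplex := by
  intro a b f hab
  by_cases h : ∃ i ∈ T, a ≤ i.castSucc ∧ i.castSucc < b
  · exact if_pos h
  · exact (if_neg h).trans (hF a b f hab)

/-- An inner face of a complex does not depend on whether the map before the omitted object is
replaced by zero. -/
theorem IsComplex.face_cut {F : Chain C (s + 1)} (hF : F.IsComplex) {T T' : Finset (Fin (s + 1))}
    (i : Fin (s + 1)) (hT : ∀ j : Fin (s + 1), (j : ℕ) + 1 ≠ i → (j ∈ T ↔ j ∈ T')) :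
    (F.cut T).face i.castSucc = (F.cut T').face i.castSucc := by
  refine CategoryTheory.Functor.hext (fun _ => rfl) fun a b f => heq_of_eq ?_
  have hab : i.castSucc.succAbove a ≤ i.castSucc.succAbove b :=
    (Fin.succAboveOrderEmb i.castSucc).monotone (leOfHom f)
  change (F.cut T).map (homOfLE hab) = (F.cut T').map (homOfLE hab)
  -- Arrows of length at least two vanish in both cuts. A shorter arrow that involves the map with
  -- index `i - 1` would end at position `i`, which the face omits.
  by_cases h : (i.castSucc.succAbove a : ℕ) + 2 ≤ i.castSucc.succAbove b
  · exact (hF.cut T _ _ (homOfLE hab) h).trans (hF.cut T' _ _ (homOfLE hab) h).symm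
  · have hb : (i.castSucc.succAbove b : ℕ) ≠ i := fun h =>
      Fin.succAbove_ne i.castSucc b (Fin.ext h)
    have key : ∀ j : Fin (s + 1), i.castSucc.succAbove a ≤ j.castSucc →
        j.castSucc < i.castSucc.succAbove b → (j ∈ T ↔ j ∈ T') := fun j h₁ h₂ => hT j (by
      have h₁' : (i.castSucc.succAbove a : ℕ) ≤ j := h₁
      have h₂' : (j : ℕ) < i.castSucc.succAbove b := h₂
      omega)
    by_cases h' : ∃ j ∈ T, i.castSucc.succAbove a ≤ j.castSucc ∧
        j.castSucc < i.castSucc.succAbove b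
    · obtain ⟨j, hj, h₁, h₂⟩ := h'
      exact (F.cut_map_of_mem hj _ h₁ h₂).trans
        (F.cut_map_of_mem ((key j h₁ h₂).1 hj) _ h₁ h₂).symm
    · refine (if_neg h').trans (Eq.symm (if_neg ?_))
      rintro ⟨j, hj, h₁, h₂⟩
      exact h' ⟨j, (key j h₁ h₂).2 hj, h₁, h₂⟩

end Chain

namespace Cochain

variable [HasZeroMorphisms C] {D : Cᵒᵖ ⥤ C ⥤ AddCommGrpCat.{v}} {s : ℕ}

/-- The value of a normalized coboundary on a complex is a sum of the two outer terms. -/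
theorem coboundary_mem_outer (b : Cochain D s) (hb : IsNormalized (coboundary D s b))
    {F : Chain C (s + 1)} (hF : F.IsComplex) :
    coboundary D s b F ∈ outer D (F.map (homOfLE (Fin.le_last (Fin.last s).castSucc)))
      (F.map (homOfLE (Fin.zero_le (Fin.succ 0)))) := by
  -- Only the coboundary of `b` is normalized, not `b`, so the inner terms of the coboundary need
  -- not vanish one by one. They are cancelled by inclusion-exclusion over the chains `F.cut T`.
  let A := (D.obj (F.obj (Fin.last (s + 1)))).obj (F.obj 0).unop
  let V : Finset (Fin (s + 1)) → Fin (s + 2) → A := fun T i =>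
    value b ((F.cut T).face i)
      ((F.cut T).map (homOfLE (Fin.le_last (i.succAbove (Fin.last s)))) ≫ 𝟙 (F.obj (Fin.last _)))
      (𝟙 (F.obj 0) ≫ (F.cut T).map (homOfLE (Fin.zero_le (i.succAbove 0))))
  have hV : ∀ T, (value (coboundary D s b) (F.cut T) (𝟙 (F.obj (Fin.last (s + 1))))
      (𝟙 (F.obj 0)) : A) = ∑ i : Fin (s + 2), ((-1 : ℤ) ^ (i : ℕ)) • V T i := fun T =>
    value_coboundary b (F.cut T) _ _
  -- For nonempty `T` the chain `F.cut T` contains a zero map, so the normalized coboundary vanishes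
  -- there and only `T = ∅` contributes.
  have hsum : (coboundary D s b F : A) =
      ∑ T : Finset (Fin (s + 1)), ((-1 : ℤ) ^ T.card) •
        (value (coboundary D s b) (F.cut T) (𝟙 (F.obj (Fin.last (s + 1)))) (𝟙 (F.obj 0)) : A) := by
    rw [Finset.sum_eq_single ∅]
    · rw [Finset.card_empty, pow_zero, one_smul]
      exact (value_id _ _).symm.trans (value_congr _ F.cut_empty HEq.rfl HEq.rfl).symm
    · intro T _ hT
      obtain ⟨i, hi⟩ := Finset.nonempty_iff_ne_empty.2 hT
      have := value_eq_zero hb (F.cut T) (𝟙 (F.obj (Fin.last (s + 1)))) (𝟙 (F.obj 0)) i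
        (congrArg Quiver.Hom.unop (F.cut_map_of_mem hi _ le_rfl i.castSucc_lt_succ))
      rw [this, smul_zero]
    · simp
  change (_ : A) ∈ _
  rw [hsum]
  simp only [hV, Finset.smul_sum]
  rw [Finset.sum_comm]
  refine AddSubgroup.sum_mem _ fun i _ => ?_
  rcases Fin.eq_zero_or_eq_succ i with rfl | ⟨j, rfl⟩
  · refine AddSubgroup.sum_mem _ fun T _ => zsmul_mem (zsmul_mem ?_ _) _
    obtain ⟨α, hα⟩ := F.cut_map_factors_left T
    exact value_mem_outer_left b ((F.cut T).face 0) _ _ _ α ((Category.id_comp _).trans hα)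
  rcases Fin.eq_castSucc_or_eq_last j with ⟨j, rfl⟩ | rfl
  · have h : ∑ T : Finset (Fin (s + 1)), ((-1 : ℤ) ^ T.card) •
        ((-1 : ℤ) ^ (j.castSucc.succ : ℕ)) • V T j.castSucc.succ = 0 := by
      refine Finset.sum_involution
        (fun T _ => if j.castSucc ∈ T then T.erase j.castSucc else insert j.castSucc T)
        ?_ ?_ ?_ ?_
      · intro T _
        have hVT : ∀ T' : Finset (Fin (s + 1)), (∀ k, k ≠ j.castSucc → (k ∈ T ↔ k ∈ T')) →
            V T j.castSucc.succ = V T' j.castSucc.succ := by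
          intro T' hT'
          have h₁ : (F.cut T).face j.castSucc.succ = (F.cut T').face j.castSucc.succ :=
            hF.face_cut j.succ fun k hk => hT' k fun h => hk (by rw [h]; rfl)
          refine value_congr b h₁ (heq_of_eq ?_) (heq_of_eq ?_)
          · have e : j.castSucc.succ.succAbove (Fin.last s) = Fin.last (s + 1) :=
              Fin.succAbove_of_le_castSucc _ _ (Fin.succ_le_castSucc_iff.2 (Fin.castSucc_lt_last j))
            have hT : ∀ T : Finset (Fin (s + 1)), (F.cut T).map
                (homOfLE (Fin.le_last (j.castSucc.succ.succAbove (Fin.last s)))) =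
                F.map (homOfLE (Fin.le_last (j.castSucc.succ.succAbove (Fin.last s)))) := fun T =>
              F.cut_map_of_not_mem _ fun k _ hk => by rwa [e] at hk
            exact congrArg (fun φ => φ ≫ 𝟙 (F.obj (Fin.last (s + 1)))) ((hT T).trans (hT T').symm)
          · have e : j.castSucc.succ.succAbove 0 = 0 :=
              Fin.succAbove_ne_zero_zero (Fin.succ_ne_zero _)
            have hT : ∀ T : Finset (Fin (s + 1)), (F.cut T).map
                (homOfLE (Fin.zero_le (j.castSucc.succ.succAbove 0))) =
                F.map (homOfLE (Fin.zero_le (j.castSucc.succ.succAbove 0))) := fun T =>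
              F.cut_map_of_not_mem _ fun k _ _ => by
                rw [e]
                exact Fin.zero_le _
            exact congrArg (fun φ => 𝟙 (F.obj 0) ≫ φ) ((hT T).trans (hT T').symm)
        by_cases hj : j.castSucc ∈ T
        · rw [if_pos hj, ← hVT (T.erase j.castSucc) fun k hk => by simp [hk],
            ← Finset.card_erase_add_one hj, pow_succ, mul_neg_one, neg_smul, neg_add_cancel]
        · rw [if_neg hj, ← hVT (insert j.castSucc T) fun k hk => by simp [hk],
            Finset.card_insert_of_notMem hj, pow_succ, mul_neg_one, neg_smul, add_neg_cancel]
      · intro T _ _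
        split_ifs with hj
        · exact fun h => Finset.notMem_erase j.castSucc T (by rwa [h])
        · exact fun h => hj (h ▸ Finset.mem_insert_self _ _)
      · exact fun _ _ => Finset.mem_univ _
      · intro T _
        by_cases hj : j.castSucc ∈ T
        · simp [hj, Finset.insert_erase]
        · simp [hj]
    rw [h]
    exact AddSubgroup.zero_mem _
  · refine AddSubgroup.sum_mem _ fun T _ => zsmul_mem (zsmul_mem ?_ _) _
    obtain ⟨β, hβ⟩ := F.cut_map_factors_right T
    have e : (Fin.last s).succ.succAbove (Fin.last s) = (Fin.last s).castSucc :=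
      Fin.succAbove_last_apply _
    refine value_mem_outer_right b ((F.cut T).face (Fin.last s).succ) _ _
      (((F.cut T).map (homOfLE e.le)) ≫ β) _ ?_
    refine (Category.comp_id _).trans (Eq.trans ?_ (Category.assoc _ _ _).symm)
    exact Eq.trans ((F.cut T).map_comp (homOfLE e.le)
      (homOfLE (Fin.le_last (Fin.last s).castSucc))) (congrArg _ hβ)

end Cochain

end BW

/-! ### The prism argument: normalized cocycles along a map of complexes. -/

section BW

variable {C : Type u} [Category.{v} C]

/-- The poset `{0, 1} × {0, …, s}`. -/
def Prism (s : ℕ) : Type := Fin 2 × Fin (s + 1)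

instance (s : ℕ) : Preorder (Prism s) := inferInstanceAs (Preorder (Fin 2 × Fin (s + 1)))

/-- The diagram on `{0, 1} × {0, …, s}` given by a map of chains. -/
def Chain.cylinder {s : ℕ} {F' F : Chain C s} (φ : F' ⟶ F) : Prism s ⥤ Cᵒᵖ where
  obj q := ((ComposableArrows.mk₁ φ).obj q.1).obj q.2
  map {p q} f := ((ComposableArrows.mk₁ φ).map (homOfLE (leOfHom f).1)).app p.2 ≫
    ((ComposableArrows.mk₁ φ).obj q.1).map (homOfLE (leOfHom f).2)
  map_id q := by
    have h₁ := (ComposableArrows.mk₁ φ).map_id q.1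
    have h₂ := ((ComposableArrows.mk₁ φ).obj q.1).map_id q.2
    exact (congrArg₂ (fun a b => NatTrans.app a q.2 ≫ b) h₁ h₂).trans (Category.comp_id _)
  map_comp {p q r} f g := by
    have h₁ := (ComposableArrows.mk₁ φ).map_comp (homOfLE (leOfHom f).1) (homOfLE (leOfHom g).1)
    have h₂ := ((ComposableArrows.mk₁ φ).obj r.1).map_comp (homOfLE (leOfHom f).2)
      (homOfLE (leOfHom g).2)
    refine (congrArg₂ (fun a b => NatTrans.app a p.2 ≫ b) h₁ h₂).trans ?_
    simp only [NatTrans.comp_app, Category.assoc, NatTrans.naturality_assoc]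

namespace Cochain

theorem along_zero {D : Cᵒᵖ ⥤ C ⥤ AddCommGrpCat.{v}} {Q : Type} [Preorder Q] {m : ℕ}
    (G : Q ⥤ Cᵒᵖ) {o t : Q} (ho : ∀ q, o ≤ q) (ht : ∀ q, q ≤ t) (σ : Fin (m + 1) →o Q) :
    along (0 : Cochain D m) G ho ht σ = 0 :=
  map_zero (transport D _ _ _).hom

end Cochain

namespace Prism

variable {s : ℕ}

/-- The simplices of the cylinder between the top and the bottom. -/
def edge (s i : ℕ) : Fin (s + 1) →o Prism s where
  toFun a := (if (a : ℕ) < i then 0 else 1, a)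
  monotone' a b h := by
    have h' : (a : ℕ) ≤ b := h
    refine ⟨?_, h⟩
    dsimp only
    split_ifs <;> omega

/-- The nondegenerate top simplices of the cylinder. -/
def simplex (i : Fin (s + 1)) : Fin (s + 2) →o Prism s where
  toFun a := (if (a : ℕ) ≤ i then 0 else 1, i.predAbove a)
  monotone' a b h := by
    have h' : (a : ℕ) ≤ b := h
    refine ⟨?_, Fin.predAbove_right_monotone i h⟩
    dsimp only
    split_ifs <;> omega

theorem simplex_snd (i : Fin (s + 1)) (a : Fin (s + 2)) :
    ((simplex i a).2 : ℕ) = if (a : ℕ) ≤ i then (a : ℕ) else a - 1 := by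
  change (i.predAbove a : ℕ) = _
  simp only [Fin.predAbove, Fin.lt_def, Fin.val_castSucc]
  split_ifs <;> simp <;> omega

/-- `simplex i` is `(0,0), …, (0,i), (1,i), …, (1,s)`. Omitting one of the two vertices in column
`i` gives `edge s i` or `edge s (i + 1)`, so successive simplices share a face and their
contributions telescope. -/
theorem simplex_comp_castSucc (i : Fin (s + 1)) :
    (simplex i).comp (Fin.succAboveOrderEmb i.castSucc).toOrderHom = edge s i := by
  refine OrderHom.ext _ _ (funext fun a => Prod.ext (Fin.ext ?_) ?_)
  · change ((if ((i.castSucc.succAbove a : Fin (s + 2)) : ℕ) ≤ i then 0 else 1 : Fin 2) : ℕ) =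
      (if (a : ℕ) < i then 0 else 1 : Fin 2)
    congr 1
    refine if_congr ?_ rfl rfl
    simp only [Fin.succAbove, Fin.lt_def, Fin.val_castSucc]
    split_ifs <;> simp
    omega
  · exact Fin.predAbove_succAbove i a

theorem simplex_comp_succ (i : Fin (s + 1)) :
    (simplex i).comp (Fin.succAboveOrderEmb i.succ).toOrderHom = edge s (i + 1) := by
  refine OrderHom.ext _ _ (funext fun a => Prod.ext (Fin.ext ?_) ?_)
  · change ((if ((i.succ.succAbove a : Fin (s + 2)) : ℕ) ≤ i then 0 else 1 : Fin 2) : ℕ) =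
      (if (a : ℕ) < i + 1 then 0 else 1 : Fin 2)
    congr 1
    refine if_congr ?_ rfl rfl
    simp only [Fin.succAbove, Fin.lt_def, Fin.val_castSucc, Fin.val_succ]
    split_ifs <;> simp
    omega
  · change i.predAbove (i.succ.succAbove a) = a
    rcases le_or_gt a i with h | h
    · rw [Fin.succAbove_of_castSucc_lt _ _ (Fin.castSucc_lt_succ_iff.2 h),
        Fin.predAbove_castSucc_of_le _ _ h]
    · rw [Fin.succAbove_of_le_castSucc _ _ (Fin.succ_le_castSucc_iff.2 h),
        Fin.predAbove_succ_of_le _ _ h.le]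

/-- The bottom of the cylinder. -/
def bot : Prism s := (0, 0)

/-- The top of the cylinder. -/
def top : Prism s := (1, Fin.last s)

theorem bot_le (q : Prism s) : bot ≤ q := ⟨Fin.zero_le _, Fin.zero_le _⟩

theorem le_top (q : Prism s) : q ≤ top := ⟨Fin.le_last _, Fin.le_last _⟩

/-- The successor of the bottom in the chain at `0`. -/
def botSucc : Prism (s + 1) := (0, Fin.succ 0)

/-- The predecessor of the top in the chain at `1`. -/
def topPred : Prism (s + 1) := (1, (Fin.last s).castSucc)

variable [HasZeroMorphisms C] {D : Cᵒᵖ ⥤ C ⥤ AddCommGrpCat.{v}}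

theorem cylinder_map_eq_zero {F' F : Chain C s} (φ : F' ⟶ F) (hF' : F'.IsComplex)
    (hF : F.IsComplex) {p q : Prism s} (f : p ⟶ q) (h : (p.2 : ℕ) + 2 ≤ q.2) :
    ((Chain.cylinder φ).map f).unop = 0 := by
  have key : ∀ (ε : Fin 2) (a b : Fin (s + 1)) (g : a ⟶ b), (a : ℕ) + 2 ≤ b →
      (((ComposableArrows.mk₁ φ).obj ε).map g).unop = 0 := by
    intro ε a b g hab
    rcases Fin.exists_fin_two.1 ⟨ε, rfl⟩ with rfl | rfl
    · exact congrArg Quiver.Hom.unop (hF' a b g hab)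
    · exact congrArg Quiver.Hom.unop (hF a b g hab)
  have := key q.1 p.2 q.2 (homOfLE (leOfHom f).2) h
  exact (congrArg (fun g => g ≫ (((ComposableArrows.mk₁ φ).map
    (homOfLE (leOfHom f).1)).app p.2).unop) this).trans zero_comp

/-- The cocycle condition on `simplex i`. The two faces at the climb have opposite signs and give
the difference. Of the others, the first and the last face are outer terms, and every remaining face
contains an arrow across two columns, which is zero, so that `c` vanishes on it. -/
theorem along_edge_sub_mem_outer {c : Cochain D (s + 1)} (hc : IsNormalized c)
    (hc' : c ∈ cocycles D (s + 1)) {F' F : Chain C (s + 1)} (φ : F' ⟶ F) (hF' : F'.IsComplex)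
    (hF : F.IsComplex) (i : Fin (s + 2)) :
    c.along (Chain.cylinder φ) bot_le le_top (edge (s + 1) i) -
      c.along (Chain.cylinder φ) bot_le le_top (edge (s + 1) (i + 1)) ∈
      Cochain.outer D ((Chain.cylinder φ).map (homOfLE (le_top topPred)))
        ((Chain.cylinder φ).map (homOfLE (bot_le botSucc))) := by
  set G := Chain.cylinder φ
  have h₀ : c.along G bot_le le_top (edge (s + 1) i) -
      c.along G bot_le le_top (edge (s + 1) (i + 1)) =
      -((-1 : ℤ) ^ (i : ℕ) • ∑ j ∈ (Finset.univ.erase i.castSucc).erase i.succ,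
        (-1 : ℤ) ^ (j : ℕ) • c.along G bot_le le_top
          ((simplex i).comp (Fin.succAboveOrderEmb j).toOrderHom)) := by
    have h := Cochain.along_coboundary c G bot_le le_top (simplex i)
    rw [show coboundary D (s + 1) c = 0 from hc', Cochain.along_zero,
      ← Finset.add_sum_erase _ _ (Finset.mem_univ i.castSucc),
      ← Finset.add_sum_erase _ _ (Finset.mem_erase.2
        ⟨Fin.castSucc_lt_succ.ne', Finset.mem_univ i.succ⟩),
      simplex_comp_castSucc, simplex_comp_succ, Fin.val_castSucc, Fin.val_succ, pow_succ] at h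
    rcases neg_one_pow_eq_or ℤ (i : ℕ) with hi | hi
    · rw [hi] at h ⊢
      rw [one_smul, mul_neg_one, neg_smul, one_smul, ← add_assoc, ← sub_eq_add_neg] at h
      rw [one_smul]
      exact eq_neg_of_add_eq_zero_left h.symm
    · rw [hi] at h ⊢
      rw [mul_neg_one, neg_neg, neg_smul, one_smul, one_smul, ← add_assoc] at h
      rw [neg_smul, one_smul, neg_neg, ← neg_inj, ← add_eq_zero_iff_eq_neg, neg_sub, h]
      abel
  rw [h₀]
  refine neg_mem (zsmul_mem (AddSubgroup.sum_mem _ fun j hj => zsmul_mem ?_ _) _)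
  have hj₁ : j ≠ i.succ := (Finset.mem_erase.1 hj).1
  have hj₂ : j ≠ i.castSucc := (Finset.mem_erase.1 (Finset.mem_erase.1 hj).2).1
  have hσ : ∀ a, (((simplex i).comp (Fin.succAboveOrderEmb j).toOrderHom a).2 : ℕ) =
    if (j.succAbove a : ℕ) ≤ i then (j.succAbove a : ℕ) else j.succAbove a - 1 := fun a =>
    simplex_snd i _
  rcases Fin.eq_zero_or_eq_succ j with rfl | ⟨k, rfl⟩
  · have h : botSucc ≤ (simplex i).comp (Fin.succAboveOrderEmb 0).toOrderHom 0 := by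
      refine ⟨Fin.zero_le _, Fin.le_def.2 ?_⟩
      rw [hσ]
      have : (i : ℕ) ≠ 0 := fun h => hj₂ (Fin.ext h.symm)
      change 1 ≤ if 1 ≤ (i : ℕ) then 1 else 1 - 1
      split_ifs <;> omega
    exact Cochain.value_mem_outer_left c _ _ _ _ (G.map (homOfLE h))
      (G.map_comp (homOfLE (bot_le botSucc)) (homOfLE h))
  rcases Fin.eq_castSucc_or_eq_last k with ⟨k, rfl⟩ | rfl
  · refine Cochain.along_eq_zero hc G bot_le le_top _ k ?_ ▸ AddSubgroup.zero_mem _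
    refine cylinder_map_eq_zero φ hF' hF _ ?_
    have h₁ : (i : ℕ) ≠ k + 1 := fun h => hj₂ (Fin.ext (by simp [h]))
    have h₂ : (i : ℕ) ≠ k := fun h => hj₁ (Fin.ext (by simp [h]))
    have e₁ : (k.castSucc.succ.succAbove k.castSucc : ℕ) = k := by
      rw [Fin.succAbove_of_castSucc_lt _ _ Fin.castSucc_lt_succ]
      rfl
    have e₂ : (k.castSucc.succ.succAbove k.succ : ℕ) = k + 2 := by
      rw [Fin.succAbove_of_le_castSucc _ _ (Fin.succ_le_castSucc_iff.2 Fin.castSucc_lt_succ)]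
      rfl
    refine (hσ k.castSucc).symm ▸ (hσ k.succ).symm ▸ ?_
    rw [e₁, e₂]
    split_ifs <;> omega
  · have h : (simplex i).comp (Fin.succAboveOrderEmb (Fin.last (s + 1)).succ).toOrderHom
        (Fin.last (s + 1)) ≤ topPred := by
      refine ⟨Fin.le_last _, Fin.le_def.2 ?_⟩
      rw [hσ]
      have h₁ : (i : ℕ) ≠ s + 1 := fun h => hj₁ (Fin.ext (by simp [h]))
      have h₂ := i.is_lt
      have e : ((Fin.last (s + 1)).succ.succAbove (Fin.last (s + 1)) : ℕ) = s + 1 := by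
        rw [Fin.succAbove_of_castSucc_lt _ _ Fin.castSucc_lt_succ]
        rfl
      rw [e]
      change _ ≤ s
      split_ifs <;> omega
    refine Cochain.value_mem_outer_right c _ _ _ (G.map (homOfLE h)) _ ?_
    exact G.map_comp (homOfLE h) (homOfLE (le_top topPred))

/-- A normalized cocycle takes the same value on the two ends of a map of complexes, up to outer
terms. -/
theorem value_sub_value_mem_outer {c : Cochain D (s + 1)} (hc : IsNormalized c)
    (hc' : c ∈ cocycles D (s + 1)) {F' F : Chain C (s + 1)} (φ : F' ⟶ F) (hF' : F'.IsComplex)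
    (hF : F.IsComplex) :
    Cochain.value c F (𝟙 _) (φ.app 0) - Cochain.value c F' (φ.app (Fin.last (s + 1))) (𝟙 _) ∈
      Cochain.outer D (F.map (homOfLE (Fin.le_last (Fin.last s).castSucc)))
        (F'.map (homOfLE (Fin.zero_le (Fin.succ 0)))) := by
  set G := Chain.cylinder φ
  -- `edge (s + 1) 0` lies entirely in row `1`, which is `F`. There are `s + 2` columns, so `edge (s
  -- + 1) (s + 2)` never climbs and lies in row `0`, which is `F'`.
  have key : ∀ k ≤ s + 2, c.along G bot_le le_top (edge (s + 1) 0) -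
      c.along G bot_le le_top (edge (s + 1) k) ∈
      Cochain.outer D (G.map (homOfLE (le_top topPred))) (G.map (homOfLE (bot_le botSucc))) := by
    intro k hk
    induction k with
    | zero =>
      rw [sub_self]
      exact AddSubgroup.zero_mem _
    | succ k ih =>
      have := add_mem (ih (by omega)) (along_edge_sub_mem_outer hc hc' φ hF' hF ⟨k, by omega⟩)
      rwa [sub_add_sub_cancel] at this
  have hG₁ : ∀ (a b : Fin (s + 2)) (h : a ≤ b),
      G.map (homOfLE (show ((1, a) : Prism (s + 1)) ≤ (1, b) from ⟨le_rfl, h⟩)) =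
        F.map (homOfLE h) := fun a b h =>
    (congrArg (fun ψ : F ⟶ F => ψ.app a ≫ F.map (homOfLE h))
      ((ComposableArrows.mk₁ φ).map_id 1)).trans (Category.id_comp _)
  have hG₀ : ∀ (a b : Fin (s + 2)) (h : a ≤ b),
      G.map (homOfLE (show ((0, a) : Prism (s + 1)) ≤ (0, b) from ⟨le_rfl, h⟩)) =
        F'.map (homOfLE h) := fun a b h =>
    (congrArg (fun ψ : F' ⟶ F' => ψ.app a ≫ F'.map (homOfLE h))
      ((ComposableArrows.mk₁ φ).map_id 0)).trans (Category.id_comp _)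
  have hG : ∀ a : Fin (s + 2),
      G.map (homOfLE (show ((0, a) : Prism (s + 1)) ≤ (1, a) from ⟨Fin.zero_le _, le_rfl⟩)) =
        φ.app a := fun a =>
    (congrArg (fun ψ => φ.app a ≫ ψ) (F.map_id a)).trans (Category.comp_id _)
  let base : Fin (s + 2) →o Prism (s + 1) := ⟨fun a => (0, a), fun _ _ h => ⟨le_rfl, h⟩⟩
  let roof : Fin (s + 2) →o Prism (s + 1) := ⟨fun a => (1, a), fun _ _ h => ⟨le_rfl, h⟩⟩
  have he₀ : edge (s + 1) (s + 2) = base :=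
    OrderHom.ext _ _ (funext fun a => Prod.ext (if_pos a.is_lt) rfl)
  have he₁ : edge (s + 1) 0 = roof :=
    OrderHom.ext _ _ rfl
  have e₁ : c.along G bot_le le_top roof = Cochain.value c F (𝟙 _) (φ.app 0) :=
    Cochain.value_congr c (F := roof.monotone.functor ⋙ G) (F' := F)
      (CategoryTheory.Functor.hext (fun _ => rfl) fun a b f => heq_of_eq (hG₁ a b (leOfHom f)))
      (heq_of_eq (G.map_id top)) (heq_of_eq (hG 0))
  have e₀ : c.along G bot_le le_top base =
      Cochain.value c F' (φ.app (Fin.last (s + 1))) (𝟙 _) :=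
    Cochain.value_congr c (F := base.monotone.functor ⋙ G) (F' := F')
      (CategoryTheory.Functor.hext (fun _ => rfl) fun a b f => heq_of_eq (hG₀ a b (leOfHom f)))
      (heq_of_eq (hG _)) (heq_of_eq (G.map_id bot))
  have h := key (s + 2) le_rfl
  rw [he₀, he₁] at h
  have er : G.map (homOfLE (le_top topPred)) =
      F.map (homOfLE (Fin.le_last (Fin.last s).castSucc)) := hG₁ _ _ _
  have ep : G.map (homOfLE (bot_le botSucc)) = F'.map (homOfLE (Fin.zero_le (Fin.succ 0))) :=
    hG₀ _ _ _
  refine (congrArg₂ (fun x y => x - y ∈ _) e₁ e₀).mp ?_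
  exact (congrArg₂ (fun r p => c.along G bot_le le_top roof - c.along G bot_le le_top base ∈
    Cochain.outer D r p) er ep).mp h

end Prism

end BW

/-! ### Evaluation of normalized cocycles on resolutions. -/

section MacLane

variable {Λ : GrRing.{v}}

namespace FreeResolution

variable {n : ℕ} {M : GrMod Λ}

theorem chain_map_succ (R : FreeResolution n M) (s : ℕ) (i : Fin s) :
    (R.chain s).map (homOfLE i.castSucc_le_succ) = (R.d i).op :=
  ComposableArrows.mkOfObjOfMapSucc_map_succ _ _ i.1 i.2

theorem isComplex_chain (R : FreeResolution n M) (s : ℕ) : (R.chain s).IsComplex := by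
  intro a b f hab
  have hb := b.is_lt
  let i : Fin s := ⟨a, by omega⟩
  let j : Fin s := ⟨a + 1, by omega⟩
  have h₁ : j.succ ≤ b := hab
  have e : (R.chain s).map f = (R.chain s).map (homOfLE i.castSucc_le_succ) ≫
      (R.chain s).map (homOfLE j.castSucc_le_succ) ≫ (R.chain s).map (homOfLE h₁) :=
    ((R.chain s).map_comp (homOfLE i.castSucc_le_succ) (homOfLE j.castSucc_le_succ ≫
      homOfLE h₁)).trans (congrArg _ ((R.chain s).map_comp _ _))
  refine e.trans ?_
  have h₂ : (R.chain s).map (homOfLE i.castSucc_le_succ) ≫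
      (R.chain s).map (homOfLE j.castSucc_le_succ) =
        (0 : R.F (a + 1 + 1) ⟶ R.F a).op :=
    (congrArg₂ (fun x y => x ≫ y) (R.chain_map_succ s i) (R.chain_map_succ s j)).trans
      (congrArg Quiver.Hom.op (R.d_comp_d a))
  refine (Category.assoc _ _ _).symm.trans ((congrArg (fun φ => φ ≫ _) h₂).trans ?_)
  exact congrArg Quiver.Hom.op (comp_zero (f := ((R.chain s).map (homOfLE h₁)).unop))

/-- A map of resolutions as a map of chains. -/
noncomputable def chainMap {R R' : FreeResolution n M} (f : ∀ i, R.F i ⟶ R'.F i)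
    (hf : ∀ i, f (i + 1) ≫ R'.d i = R.d i ≫ f i) (s : ℕ) : R'.chain s ⟶ R.chain s :=
  ComposableArrows.homMk (fun i => (f i).op) (fun i hi => by
    have h₁ := R'.chain_map_succ s ⟨i, hi⟩
    have h₂ := R.chain_map_succ s ⟨i, hi⟩
    exact (congrArg (fun φ => φ ≫ (f (i + 1)).op) h₁).trans
      ((congrArg Quiver.Hom.op (hf i)).trans (congrArg (fun φ => (f i).op ≫ φ) h₂).symm))

/-- The sum of outer terms becomes divisible by the last map after augmentation. -/
theorem comp_aug_of_mem_outer {t : ℤ} {X₁ X : FreeCat Λ n} (R : FreeResolution n M)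
    (r : X ⟶ X₁) (x : X.obj ⟶ (GrMod.shift t).obj (R.F 0).obj)
    (hx : x ∈ Cochain.outer (homBimodule Λ n t) r.op (R.d 0).op) :
    ∃ v : X₁.obj ⟶ (GrMod.shift t).obj M, x ≫ (GrMod.shift t).map R.aug = r.hom ≫ v := by
  -- The term through `λ_1` dies under the augmentation; the other one begins with `r`.
  obtain ⟨_, ⟨a, rfl⟩, _, ⟨b, rfl⟩, rfl⟩ := AddSubgroup.mem_sup.1 hx
  refine ⟨(show X₁.obj ⟶ (GrMod.shift t).obj (R.F 0).obj from b) ≫ (GrMod.shift t).map R.aug, ?_⟩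
  dsimp only
  change ((show X.obj ⟶ (GrMod.shift t).obj (R.F 1).obj from a) ≫
    (GrMod.shift t).map (R.d 0).hom +
    r.hom ≫ (show X₁.obj ⟶ (GrMod.shift t).obj (R.F 0).obj from b)) ≫ _ = _
  rw [Preadditive.add_comp, Category.assoc, Category.assoc, ← Functor.map_comp, R.d_comp_aug]
  ext k x
  rw [GrMod.add_app]
  exact zero_add _

/-- The evaluation of normalized cocycles that represent the same class agree up to maps that
extend over the last differential. -/
theorem eval_comparison {q : ℕ} {t : ℤ} {γ : HML Λ n (q + 2) t} {R R' : FreeResolution n M}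
    {c c' : Cochain (homBimodule Λ n t) (q + 2)} (hc : NormalizedRep c γ)
    (hc' : NormalizedRep c' γ) (f : ∀ i, R.F i ⟶ R'.F i) (hf₀ : (f 0).hom ≫ R'.aug = R.aug)
    (hf : ∀ i, f (i + 1) ≫ R'.d i = R.d i ≫ f i) :
    ∃ w : (R.F (q + 1)).obj ⟶ (GrMod.shift t).obj M,
      R.eval c ≫ (GrMod.shift t).map R.aug = (f (q + 2)).hom ≫ R'.eval c' ≫
        (GrMod.shift t).map R'.aug + (R.d (q + 1)).hom ≫ w := by
  obtain ⟨hn, hz, rfl⟩ := hc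
  obtain ⟨hn', hz', h⟩ := hc'
  obtain ⟨b, hb⟩ : c' - c ∈ (coboundary (homBimodule Λ n t) (q + 1)).range := by
    have := (QuotientAddGroup.eq).1 h.symm
    rw [AddSubgroup.mem_addSubgroupOf] at this
    have e : ((-(⟨c, hz⟩ : cocycles (homBimodule Λ n t) (q + 2)) + ⟨c', hz'⟩ :
      cocycles (homBimodule Λ n t) (q + 2)) : Cochain (homBimodule Λ n t) (q + 2)) = c' - c :=
      neg_add_eq_sub c c'
    rw [e] at this
    exact this
  -- The cochain `b` is arbitrary, but its coboundary is a difference of two normalized cocycles.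
  have hbn : IsNormalized (coboundary (homBimodule Λ n t) (q + 1) b) := by
    intro F hF
    rw [hb]
    change c' F - c F = 0
    rw [hn F hF, hn' F hF, sub_zero]
  have h₁ := Cochain.coboundary_mem_outer b hbn (R'.isComplex_chain (q + 2))
  have h₂ := Prism.value_sub_value_mem_outer hn hz (chainMap f hf (q + 2))
    (R'.isComplex_chain (q + 2)) (R.isComplex_chain (q + 2))
  have er : ∀ R : FreeResolution n M,
      (R.chain (q + 2)).map (homOfLE (Fin.le_last (Fin.last (q + 1)).castSucc)) =
        (R.d (q + 1)).op := fun R => R.chain_map_succ (q + 2) (Fin.last (q + 1))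
  have ep : (R'.chain (q + 2)).map (homOfLE (Fin.zero_le (Fin.succ 0))) = (R'.d 0).op :=
    R'.chain_map_succ (q + 2) 0
  obtain ⟨v₁, hv₁⟩ := R'.comp_aug_of_mem_outer (R'.d (q + 1)) (R'.eval c' - R'.eval c)
    ((congrArg₂ (fun r p => R'.eval c' - R'.eval c ∈
      Cochain.outer (homBimodule Λ n t) r p) (er R') ep).mp (by
        have e : coboundary (homBimodule Λ n t) (q + 1) b (R'.chain (q + 2)) =
          R'.eval c' - R'.eval c := congrFun hb _
        exact e ▸ h₁))
  obtain ⟨v₂, hv₂⟩ := R'.comp_aug_of_mem_outer (R.d (q + 1))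
    (R.eval c ≫ (GrMod.shift t).map (f 0).hom - (f (q + 2)).hom ≫ R'.eval c)
    ((congrArg₂ (fun r p => R.eval c ≫ (GrMod.shift t).map (f 0).hom -
      (f (q + 2)).hom ≫ R'.eval c ∈ Cochain.outer (homBimodule Λ n t) r p) (er R) ep).mp h₂)
  -- `v₂` comes from changing the resolution with `c` fixed, `v₁` from changing the cocycle on `R'`;
  -- the latter is pulled back along the comparison map.
  refine ⟨v₂ - (f (q + 1)).hom ≫ v₁, ?_⟩
  have hf' : (f (q + 2)).hom ≫ (R'.d (q + 1)).hom = (R.d (q + 1)).hom ≫ (f (q + 1)).hom :=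
    congrArg (fun φ => φ.hom) (hf (q + 1))
  rw [Preadditive.sub_comp] at hv₁ hv₂
  rw [Category.assoc, Category.assoc, ← Functor.map_comp, hf₀] at hv₂
  rw [Preadditive.comp_sub, ← hv₂, ← reassoc_of% hf', ← hv₁, Preadditive.comp_sub]
  abel

end FreeResolution

end MacLane

/-! ### Independence of the cup product from resolution and cocycle. -/

section CupProduct

variable {Λ : GrRing.{v}}

namespace GrMod

/-- The map `P ⟶ pushout f g`. -/
def pushoutInr {B B' P : GrMod Λ} (f : B ⟶ B') (g : B ⟶ P) : P ⟶ pushout f g where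
  app k := (QuotientAddGroup.mk' (pushoutRel f g k)).comp (AddMonoidHom.inr _ _)
  map_smul {i j k} h x a := by
    refine congrArg (QuotientAddGroup.mk) (Prod.ext ?_ rfl)
    exact (B'.zero_smul h a).symm

theorem pushoutInr_app_eq {B B' P : GrMod Λ} (f : B ⟶ B') (g : B ⟶ P) (k : ℤ) (b : B.carrier k) :
    (pushoutInr f g).app k (g.app k b) = (pushoutInl f g).app k (f.app k b) := by
  refine (QuotientAddGroup.eq).2 ⟨b, Prod.ext ?_ ?_⟩
  · change f.app k b = -0 + f.app k b
    simp
  · change -(g.app k b) = -(g.app k b) + 0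
    simp

/-- The restriction of a map to kernels. -/
def kerMap {M N M' N' : GrMod Λ} {f : M ⟶ N} {f' : M' ⟶ N'} (u : M ⟶ M') (w : N ⟶ N')
    (h : u ≫ f' = f ≫ w) : ker f ⟶ ker f' where
  app k := ((u.app k).comp (f.app k).ker.subtype).codRestrict _ fun x => by
    have hx : f.app k x.1 = 0 := x.2
    change f'.app k (u.app k x.1) = 0
    rw [← comp_app, h, comp_app, hx, map_zero]
  map_smul h x a := Subtype.ext (u.map_smul h x.1 a)

theorem zsmul_app {M N : GrMod Λ} (f : M ⟶ N) (m : ℤ) (k : ℤ) (x : M.carrier k) :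
    (m • f).app k x = m • f.app k x := by
  let ev : (M ⟶ N) →+ N.carrier k :=
    { toFun := fun f => f.app k x
      map_zero' := rfl
      map_add' := fun _ _ => rfl }
  exact map_zsmul ev m f

end GrMod

namespace FreeResolution

variable {n : ℕ} {M : GrMod Λ}

/-- A summand of `τ` that extends to a map `w` on `M_{q+1}` does not change the class: `w` is
absorbed into the component of the morphism of extensions from `M_{q+1}` to the pushout. -/
theorem push_truncation_eq {q : ℕ} {B : GrMod Λ} (R R' : FreeResolution n M)
    (f : ∀ i, R.F i ⟶ R'.F i) (hf₀ : (f 0).hom ≫ R'.aug = R.aug)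
    (hf : ∀ i, f (i + 1) ≫ R'.d i = R.d i ≫ f i)
    (τ : GrMod.ker (R.d q).hom ⟶ B) (τ' : GrMod.ker (R'.d q).hom ⟶ B)
    (w : (R.F (q + 1)).obj ⟶ B)
    (h : τ = GrMod.kerMap (f (q + 1)).hom (f q).hom (congrArg (fun φ => φ.hom) (hf q)) ≫ τ' +
      GrMod.kerι (R.d q).hom ≫ w) :
    ((R.truncation q).push τ).toExt = ((R'.truncation q).push τ').toExt := by
  refine YExtension.push_toExt (R.truncation q) ((R'.truncation q).push τ') τ
    (fun i _ => (f i).hom) (w ≫ GrMod.pushoutInl τ' (GrMod.kerι (R'.d q).hom) +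
      (f (q + 1)).hom ≫ GrMod.pushoutInr τ' (GrMod.kerι (R'.d q).hom)) hf₀
    (fun i _ => congrArg (fun φ => φ.hom) (hf i)) ?_ ?_
  · ext k x
    change (R'.d q).hom.app k (0 + (f (q + 1)).hom.app k x) = (f q).hom.app k ((R.d q).hom.app k x)
    rw [zero_add]
    exact congrArg (fun φ => φ.hom.app k x) (hf q)
  · subst h
    ext k x
    have := GrMod.pushoutInr_app_eq τ' (GrMod.kerι (R'.d q).hom) k
      ((GrMod.kerMap (f (q + 1)).hom (f q).hom (congrArg (fun φ => φ.hom) (hf q))).app k x)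
    change (GrMod.pushoutInl τ' (GrMod.kerι (R'.d q).hom)).app k (w.app k x.1) +
      (GrMod.pushoutInr τ' (GrMod.kerι (R'.d q).hom)).app k ((f (q + 1)).hom.app k x.1) =
      (GrMod.pushoutInl τ' (GrMod.kerι (R'.d q).hom)).app k (τ'.app k _ + w.app k x.1)
    rw [map_add]
    exact (add_comm _ _).trans (congrArg (· + _) this)

end FreeResolution

/-- The product `id ∪ γ` can be computed with any resolution and any normalized cocycle. -/
theorem isCupProduct_id_iff {n q : ℕ} {t : ℤ} {M : GrMod Λ} {γ : HML Λ n (q + 2) t}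
    (R : FreeResolution n M) (c : Cochain (homBimodule Λ n t) (q + 2)) (hc : NormalizedRep c γ)
    (τ : GrMod.ker (R.d q).hom ⟶ (GrMod.shift t).obj M)
    (hτ : ∀ (k : ℤ) (x : (R.F (q + 2)).obj.carrier k) (z : (GrMod.ker (R.d q).hom).carrier k),
      (GrMod.kerι (R.d q).hom).app k z = (R.d (q + 1)).hom.app k x →
      τ.app k z = (R.eval c ≫ (GrMod.shift t).map R.aug).app k x)
    (ξ : YExt q M ((GrMod.shift t).obj M)) :
    IsCupProduct n (𝟙 M) γ ξ ↔
      ξ = ((R.truncation q).push (((-1 : ℤ) ^ (n * (n + 1) / 2)) • τ)).toExt := by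
  constructor
  · rintro ⟨R', c', hc', τ', hτ', rfl⟩
    obtain ⟨f, hf₀, hf⟩ := R.exists_comparison R'
    obtain ⟨w, hw⟩ := FreeResolution.eval_comparison hc hc' f hf₀ hf
    rw [CategoryTheory.Functor.map_id, Category.comp_id]
    refine (R.push_truncation_eq R' f hf₀ hf _ _ (((-1 : ℤ) ^ (n * (n + 1) / 2)) • w) ?_).symm
    rw [Preadditive.comp_zsmul, Preadditive.comp_zsmul, ← smul_add]
    congr 1
    ext k z
    -- By exactness every element of the kernel is some `λ_{q+2} x`, where both sides are given by
    -- evaluated cocycles and `eval_comparison` applies.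
    obtain ⟨x, hx⟩ := (R.exact (q + 1) k z.1).1 z.2
    have e₁ := hτ k x z hx.symm
    rw [hw] at e₁
    refine e₁.trans ?_
    have e₂ := hτ' k ((f (q + 2)).hom.app k x)
      ((GrMod.kerMap (f (q + 1)).hom (f q).hom (congrArg (fun φ => φ.hom) (hf q))).app k z) (by
        have := congrArg (fun φ => φ.hom.app k x) (hf (q + 1))
        refine Eq.trans ?_ this.symm
        exact congrArg ((f (q + 1)).hom.app k) hx.symm)
    refine (congrArg₂ (· + ·) e₂.symm (congrArg (w.app k) hx) :)
  · rintro rfl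
    refine ⟨R, c, hc, τ, hτ, ?_⟩
    rw [CategoryTheory.Functor.map_id, Category.comp_id]

end CupProduct

/-! ### Suspension, and the kernel of `π_j` in a Postnikov system. -/

section Triangulated

variable {C : Type u} [Category.{v} C] [HasShift C ℤ]

/-- The map `N[i + j] ⟶ Y[j]` obtained from `z : N[i] ⟶ Y` by applying the `j`-th shift. -/
def suspend {N Y : C} {i j k : ℤ} (h : i + j = k) (z : N⟦i⟧ ⟶ Y) : N⟦k⟧ ⟶ Y⟦j⟧ :=
  (shiftFunctorAdd' C i j k h).hom.app N ≫ z⟦j⟧'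

theorem suspend_comp {N Y Y' : C} {i j k : ℤ} (h : i + j = k) (z : N⟦i⟧ ⟶ Y) (g : Y ⟶ Y') :
    suspend h (z ≫ g) = suspend h z ≫ g⟦j⟧' := by
  simp [suspend]

theorem suspend_bijective {N Y : C} {i j k : ℤ} (h : i + j = k) :
    Function.Bijective (suspend h : (N⟦i⟧ ⟶ Y) → (N⟦k⟧ ⟶ Y⟦j⟧)) := by
  constructor
  · intro z z' hz
    exact (shiftFunctor C j).map_injective ((cancel_epi _).1 hz)
  · intro w
    obtain ⟨z, hz⟩ := (shiftFunctor C j).map_surjective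
      ((shiftFunctorAdd' C i j k h).inv.app N ≫ w)
    exact ⟨z, by simp [suspend, hz]⟩

/-- Scalars act by precomposition on the source, so suspension is linear over `Λ` without a sign. -/
theorem suspend_shiftedComp {N Y : C} {i j k n i' k' : ℤ} (h : i + j = k) (hi : i + n = i')
    (hk : k + n = k') (h' : i' + j = k') (z : N⟦i⟧ ⟶ Y) (a : N⟦j⟧ ⟶ N) :
    suspend hk (shiftedComp h z a) = shiftedComp h' (suspend hi z) a := by
  unfold suspend shiftedComp
  have e := shiftFunctorAdd'_assoc_hom_app j i n k i' k' (by omega) (by omega) (by omega) N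
  have nat := (shiftFunctorAdd' C i n i' hi).hom.naturality a
  simp only [Functor.comp_map] at nat
  simp only [Functor.map_comp]
  rw [reassoc_of% nat, reassoc_of% e]

theorem suspend_suspend {N Y : C} {i i' j l k : ℤ} {m : ℤ} (h : i + l = i') (h' : i' + j = k)
    (hm : l + j = m) (hk : i + m = k) (z : N⟦i⟧ ⟶ Y) :
    suspend h' (suspend h z) ≫ (shiftFunctorAdd' C l j m hm).inv.app Y = suspend hk z := by
  unfold suspend
  have e := shiftFunctorAdd'_assoc_hom_app i l j i' m k h hm (by omega) N
  have nat := (shiftFunctorAdd' C l j m hm).inv.naturality z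
  simp only [Functor.comp_map] at nat
  simp only [Functor.map_comp, Category.assoc]
  rw [nat, reassoc_of% e]
  simp

theorem suspend_zero {N Y : C} {k : ℤ} (z : N⟦k⟧ ⟶ Y) :
    suspend (add_zero k) z = z ≫ (shiftFunctorZero C ℤ).inv.app Y := by
  unfold suspend
  rw [shiftFunctorAdd'_add_zero_hom_app]
  exact ((shiftFunctorZero C ℤ).inv.naturality z).symm

variable [Preadditive C] [∀ n : ℤ, (shiftFunctor C n).Additive]

theorem suspend_add {N Y : C} {i j k : ℤ} (h : i + j = k) (z z' : N⟦i⟧ ⟶ Y) :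
    suspend h (z + z') = suspend h z + suspend h z' := by
  simp [suspend, Functor.map_add]

theorem suspend_zero_map {N Y : C} {i j k : ℤ} (h : i + j = k) :
    suspend h (0 : N⟦i⟧ ⟶ Y) = 0 := by
  simp [suspend]

theorem suspend_eq_zero_iff {N Y : C} {i j k : ℤ} (h : i + j = k) (z : N⟦i⟧ ⟶ Y) :
    suspend h z = 0 ↔ z = 0 :=
  ⟨fun hz => (suspend_bijective h).1 (hz.trans (suspend_zero_map h).symm),
    fun hz => hz ▸ suspend_zero_map h⟩

variable [HasZeroObject C] [Pretriangulated C]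

namespace PostnikovSystem

variable {N : C} {M : GrMod (endRing N)} {k : ℕ} (S : PostnikovSystem N M k)

/-- The augmentation on maps `N[i] ⟶ X_0`. -/
def augHom (i : ℤ) : (N⟦i⟧ ⟶ S.X 0) →+ M.carrier i := S.aug.app i

theorem augHom_surjective (i : ℤ) : Function.Surjective (S.augHom i) := S.aug_surjective i

theorem exact_zero (hk : 0 < k) {i : ℤ} (x : N⟦i⟧ ⟶ S.X 0) :
    S.augHom i x = 0 ↔ ∃ y : N⟦i⟧ ⟶ S.X 1, y ≫ S.iota 0 ≫ S.pi 0 = x :=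
  S.exact 0 hk i x

theorem exact_succ {j : ℕ} (hj : j + 1 < k) {i : ℤ} (x : N⟦i⟧ ⟶ S.X (j + 1)) :
    x ≫ S.iota j ≫ S.pi j = 0 ↔
      ∃ y : N⟦i⟧ ⟶ S.X (j + 2), y ≫ S.iota (j + 1) ≫ S.pi (j + 1) = x :=
  S.exact (j + 1) hj i x

theorem pi_iota {j : ℕ} (hj : j + 1 < k) : S.pi (j + 1) ≫ S.iota j = 0 :=
  comp_distTriang_mor_zero₁₂ _ (S.distinguished j hj)

theorem iota_alpha {j : ℕ} (hj : j + 1 < k) : S.iota j ≫ S.alpha j = 0 :=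
  comp_distTriang_mor_zero₂₃ _ (S.distinguished j hj)

theorem alpha_pi {j : ℕ} (hj : j + 1 < k) : S.alpha j ≫ (S.pi (j + 1))⟦(1 : ℤ)⟧' = 0 :=
  comp_distTriang_mor_zero₃₁ _ (S.distinguished j hj)

theorem comp_alpha_eq_zero_iff {j : ℕ} (hj : j + 1 < k) {A : C} (w : A ⟶ S.Y j) :
    w ≫ S.alpha j = 0 ↔ ∃ x, w = x ≫ S.iota j := by
  constructor
  · exact Triangle.coyoneda_exact₃ _ (S.distinguished j hj) w
  · rintro ⟨x, rfl⟩
    rw [Category.assoc, S.iota_alpha hj, comp_zero]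

theorem comp_pi_eq_zero_iff {j : ℕ} (hj : j + 1 < k) {i i' : ℤ} (h : i + 1 = i')
    (z : N⟦i⟧ ⟶ S.Y (j + 1)) :
    z ≫ S.pi (j + 1) = 0 ↔ ∃ w, suspend h z = w ≫ S.alpha j := by
  rw [← suspend_eq_zero_iff h, suspend_comp]
  constructor
  · exact Triangle.coyoneda_exact₁ _ (S.distinguished j hj) (suspend h z)
  · rintro ⟨w, hw⟩
    rw [hw, Category.assoc, S.alpha_pi hj, comp_zero]

/-- `z : N[i] ⟶ Y_j` is the image of `y : N[i + j] ⟶ Y_0` under `α_j ⋯ α_1`. -/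
def IsImage (j : ℕ) {i l : ℤ} (h : i + j = l) (z : N⟦i⟧ ⟶ S.Y j) (y : N⟦l⟧ ⟶ S.Y 0) : Prop :=
  suspend h z = y ≫ S.alphaComp j

theorem exists_isImage (j : ℕ) {i l : ℤ} (h : i + j = l) (y : N⟦l⟧ ⟶ S.Y 0) :
    ∃ z, S.IsImage j h z y :=
  (suspend_bijective h).2 _

theorem isImage_succ_iff {j : ℕ} {i i' l : ℤ} (h : i + 1 = i') (h' : i' + j = l)
    (h'' : i + (j + 1 : ℕ) = l) {z' : N⟦i⟧ ⟶ S.Y (j + 1)} {z : N⟦i'⟧ ⟶ S.Y j}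
    {y : N⟦l⟧ ⟶ S.Y 0} (hz : S.IsImage j h' z y) :
    S.IsImage (j + 1) h'' z' y ↔ suspend h z' = z ≫ S.alpha j := by
  unfold IsImage at hz ⊢
  rw [alphaComp, ← reassoc_of% hz, ← suspend_suspend h h' (by push_cast; ring) h'' z',
    ← Category.assoc (suspend h' z), ← suspend_comp, cancel_mono]
  exact (suspend_bijective h').1.eq_iff

theorem isImage_zero_iff {l : ℤ} (h : l + (0 : ℕ) = l) {z y : N⟦l⟧ ⟶ S.Y 0} :
    S.IsImage 0 h z y ↔ z = y := by
  have e : suspend h z = z ≫ (shiftFunctorZero C ℤ).inv.app (S.Y 0) := suspend_zero z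
  unfold IsImage
  rw [alphaComp, e, cancel_mono]

theorem isImage_one_iff {i l : ℤ} (h : i + 1 = l) (h' : i + (1 : ℕ) = l)
    {z' : N⟦i⟧ ⟶ S.Y 1} {y : N⟦l⟧ ⟶ S.Y 0} :
    S.IsImage 1 h' z' y ↔ suspend h z' = y ≫ S.alpha 0 :=
  S.isImage_succ_iff h (by simp) h' ((S.isImage_zero_iff (by simp)).2 rfl)

/-- Together the two parts say that `α_{j+1} ⋯ α_1` identifies `M[-(j+1)]` with the kernel of
`π_{j+1}`. They are proved jointly because the inductive step of the first uses both. -/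
theorem isImage_aux (j : ℕ) (hj : j + 1 < k) :
    (∀ {i l : ℤ} (h : i + (j + 1 : ℕ) = l) (z : N⟦i⟧ ⟶ S.Y (j + 1)) (y : N⟦l⟧ ⟶ S.Y 0),
      S.IsImage (j + 1) h z y → (z = 0 ↔ S.augHom l (y ≫ S.pi 0) = 0)) ∧
    (∀ {i l : ℤ} (h : i + (j + 1 : ℕ) = l) (z : N⟦i⟧ ⟶ S.Y (j + 1)),
      z ≫ S.pi (j + 1) = 0 ↔ ∃ y, S.IsImage (j + 1) h z y) := by
  have := S.isIso_pi_zero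
  induction j with
  | zero =>
    constructor
    · intro i l h z y hz
      have h' : i + 1 = l := by simpa using h
      rw [← suspend_eq_zero_iff h', (S.isImage_one_iff h' h).1 hz, S.comp_alpha_eq_zero_iff hj,
        S.exact_zero (by omega)]
      refine exists_congr fun x => ?_
      rw [← Category.assoc, cancel_mono]
      exact eq_comm
    · intro i l h z
      have h' : i + 1 = l := by simpa using h
      rw [S.comp_pi_eq_zero_iff hj h']
      exact exists_congr fun y => (S.isImage_one_iff h' h).symm
  | succ j ih =>
    obtain ⟨ih₁, ih₂⟩ := ih (by omega)
    constructor
    · intro i l h z' y hz'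
      have h' : i + 1 + (j + 1 : ℕ) = l := by push_cast at h ⊢; omega
      obtain ⟨z, hz⟩ := S.exists_isImage (j + 1) h' y
      rw [← ih₁ h' z y hz, ← suspend_eq_zero_iff rfl z',
        (S.isImage_succ_iff rfl h' h hz).1 hz', S.comp_alpha_eq_zero_iff hj]
      constructor
      · rintro ⟨x, rfl⟩
        -- As an image, `x ≫ ι` is killed by `π`, so `x` is a cycle. Exactness makes it a boundary,
        -- and boundaries die because `π ≫ ι = 0`.
        have h₀ := (ih₂ h' _).2 ⟨y, hz⟩
        rw [Category.assoc] at h₀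
        obtain ⟨x', rfl⟩ := (S.exact_succ hj x).1 h₀
        rw [Category.assoc, Category.assoc, S.pi_iota hj, comp_zero, comp_zero]
      · rintro rfl
        exact ⟨0, zero_comp.symm⟩
    · intro i l h z'
      have h' : i + 1 + (j + 1 : ℕ) = l := by push_cast at h ⊢; omega
      rw [S.comp_pi_eq_zero_iff hj rfl]
      constructor
      · rintro ⟨w, hw⟩
        -- Modulo `X_{j+2}` the map `w` can be moved into the kernel of `π`, where the induction
        -- hypothesis applies; `α` does not see the correction, since `ι ≫ α = 0`.
        obtain ⟨x, hx⟩ := (S.exact_succ (by omega) (w ≫ S.pi (j + 1))).1 (by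
          rw [Category.assoc, reassoc_of% S.pi_iota (show j + 1 < k by omega), zero_comp,
            comp_zero])
        obtain ⟨y, hy⟩ := (ih₂ h' (w - x ≫ S.iota (j + 1))).1 (by
          rw [Preadditive.sub_comp, Category.assoc, hx, sub_self])
        refine ⟨y, (S.isImage_succ_iff rfl h' h hy).2 ?_⟩
        rw [Preadditive.sub_comp, Category.assoc, S.iota_alpha hj, comp_zero, sub_zero, hw]
      · rintro ⟨y, hy⟩
        obtain ⟨z, hz⟩ := S.exists_isImage (j + 1) h' y
        exact ⟨z, (S.isImage_succ_iff rfl h' h hz).1 hy⟩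

theorem eq_zero_iff_of_isImage {j : ℕ} (hj : 0 < j) (hjk : j < k) {i l : ℤ} (h : i + j = l)
    {z : N⟦i⟧ ⟶ S.Y j} {y : N⟦l⟧ ⟶ S.Y 0} (hz : S.IsImage j h z y) :
    z = 0 ↔ S.augHom l (y ≫ S.pi 0) = 0 := by
  obtain ⟨j, rfl⟩ := Nat.exists_eq_add_one.2 hj
  exact (S.isImage_aux j hjk).1 h z y hz

theorem comp_pi_eq_zero_iff_exists_isImage {j : ℕ} (hj : 0 < j) (hjk : j < k) {i l : ℤ}
    (h : i + j = l) (z : N⟦i⟧ ⟶ S.Y j) : z ≫ S.pi j = 0 ↔ ∃ y, S.IsImage j h z y := by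
  obtain ⟨j, rfl⟩ := Nat.exists_eq_add_one.2 hj
  exact (S.isImage_aux j hjk).2 h z

end PostnikovSystem

end Triangulated

/-! ### The induced map `η` and the obstruction extension. -/

section Triangulated

variable {C : Type u} [Category.{v} C] [HasShift C ℤ] [Preadditive C]
  [∀ n : ℤ, (shiftFunctor C n).Additive] [HasZeroObject C] [Pretriangulated C]

namespace PostnikovSystem

section

variable {N : C} {M : GrMod (endRing N)} {k : ℕ} (S : PostnikovSystem N M k)

theorem isImage_add {j : ℕ} {i l : ℤ} (h : i + j = l) {z z' : N⟦i⟧ ⟶ S.Y j}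
    {y y' : N⟦l⟧ ⟶ S.Y 0} (hz : S.IsImage j h z y) (hz' : S.IsImage j h z' y') :
    S.IsImage j h (z + z') (y + y') := by
  unfold IsImage at hz hz' ⊢
  rw [suspend_add, hz, hz', Preadditive.add_comp]

theorem isImage_sub {j : ℕ} {i l : ℤ} (h : i + j = l) {z z' : N⟦i⟧ ⟶ S.Y j}
    {y y' : N⟦l⟧ ⟶ S.Y 0} (hz : S.IsImage j h z y) (hz' : S.IsImage j h z' y') :
    S.IsImage j h (z - z') (y - y') := by
  unfold IsImage at hz hz' ⊢
  have : suspend h (z - z') = suspend h z - suspend h z' := by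
    rw [eq_sub_iff_add_eq, ← suspend_add, sub_add_cancel]
  rw [this, hz, hz', Preadditive.sub_comp]

theorem isImage_shiftedComp {j : ℕ} {i l m i' l' : ℤ} (h : i + j = l) (h' : i' + j = l')
    (hi : i + m = i') (hl : l + m = l') {z : N⟦i⟧ ⟶ S.Y j} {y : N⟦l⟧ ⟶ S.Y 0} (a : N⟦m⟧ ⟶ N)
    (hz : S.IsImage j h z y) : S.IsImage j h' (shiftedComp hi z a) (shiftedComp hl y a) := by
  unfold IsImage at hz ⊢
  rw [suspend_shiftedComp hi h h' hl, hz]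
  simp [shiftedComp]

end

variable {N : C} {M : GrMod (endRing N)} {n : ℕ} (S : PostnikovSystem N M (n + 1))

theorem exists_lift_isImage (i : ℤ) (m : M.carrier (i - -(n : ℤ))) :
    ∃ z : N⟦i⟧ ⟶ S.Y n, ∃ y : N⟦i - -(n : ℤ)⟧ ⟶ S.Y 0,
      S.IsImage n (by omega) z y ∧ S.augHom _ (y ≫ S.pi 0) = m := by
  have := S.isIso_pi_zero
  obtain ⟨x, rfl⟩ := S.augHom_surjective _ m
  obtain ⟨z, hz⟩ := S.exists_isImage n (show i + (n : ℤ) = i - -(n : ℤ) by omega) (x ≫ inv (S.pi 0))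
  exact ⟨z, _, hz, by simp⟩

theorem isImage_unique (hn : 1 ≤ n) {i l : ℤ} (h : i + n = l) {z z' : N⟦i⟧ ⟶ S.Y n}
    {y y' : N⟦l⟧ ⟶ S.Y 0} (hz : S.IsImage n h z y) (hz' : S.IsImage n h z' y')
    (hy : S.augHom l (y ≫ S.pi 0) = S.augHom l (y' ≫ S.pi 0)) : z = z' := by
  rw [← sub_eq_zero, S.eq_zero_iff_of_isImage hn (Nat.lt_succ_self n) h (S.isImage_sub h hz hz'),
    Preadditive.sub_comp, map_sub, hy, sub_self]

/-- The map `N[i] ⟶ Y_n` that belongs to an element of `M[-n]_i`. -/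
noncomputable def etaFun (i : ℤ) (m : M.carrier (i - -(n : ℤ))) : N⟦i⟧ ⟶ S.Y n :=
  (S.exists_lift_isImage i m).choose

/-- Independence of the choice in `etaFun`; additivity and linearity of `eta` follow from it. -/
theorem etaFun_eq (hn : 1 ≤ n) {i : ℤ} {z : N⟦i⟧ ⟶ S.Y n} {y : N⟦i - -(n : ℤ)⟧ ⟶ S.Y 0}
    (h : S.IsImage n (by omega) z y) : S.etaFun i (S.augHom _ (y ≫ S.pi 0)) = z := by
  obtain ⟨y', hy', e⟩ := (S.exists_lift_isImage i (S.augHom _ (y ≫ S.pi 0))).choose_spec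
  exact S.isImage_unique hn _ hy' h e

/-- The map `M[-n] ⟶ T(N, Y_n)_*` induced by `α_n ⋯ α_1`. -/
noncomputable def eta (hn : 1 ≤ n) :
    (GrMod.shift (-(n : ℤ))).obj M ⟶ (gradedHom N).obj (S.Y n) where
  app i := AddMonoidHom.mk' (fun m => S.etaFun i m) (by
    intro m m'
    obtain ⟨z, y, h, rfl⟩ := S.exists_lift_isImage i m
    obtain ⟨z', y', h', rfl⟩ := S.exists_lift_isImage i m'
    have h'' := S.isImage_add _ h h'
    have e := S.etaFun_eq hn h''
    rw [Preadditive.add_comp, map_add] at e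
    refine e.trans (congrArg₂ (· + ·) (S.etaFun_eq hn h).symm (S.etaFun_eq hn h').symm))
  map_smul {i j k} h m a := by
    obtain ⟨z, y, hz, rfl⟩ := S.exists_lift_isImage i m
    have hl : i - -(n : ℤ) + j = k - -(n : ℤ) := by omega
    have hz' := S.isImage_shiftedComp _ (by omega) h hl a hz
    have e := S.etaFun_eq hn hz'
    have e' : S.augHom (k - -(n : ℤ)) (shiftedComp hl y a ≫ S.pi 0) =
        M.smul hl (S.augHom _ (y ≫ S.pi 0)) a :=
      Eq.trans (congrArg (S.augHom _) (show _ = shiftedComp hl (y ≫ S.pi 0) a by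
        simp [shiftedComp])) (S.aug.map_smul hl _ a)
    rw [e'] at e
    exact e.trans (congrArg (fun z => shiftedComp h z a) (S.etaFun_eq hn hz).symm)

theorem eta_app (hn : 1 ≤ n) {i : ℤ} {z : N⟦i⟧ ⟶ S.Y n} {y : N⟦i - -(n : ℤ)⟧ ⟶ S.Y 0}
    (h : S.IsImage n (by omega) z y) : (S.eta hn).app i (S.augHom _ (y ≫ S.pi 0)) = z :=
  S.etaFun_eq hn h

theorem isInduced_eta (hn : 1 ≤ n) : S.IsInduced (S.eta hn) := by
  rintro i y z rfl
  obtain ⟨z, hz⟩ := S.exists_isImage n (show i + (n : ℤ) = i - -(n : ℤ) by omega) y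
  exact (congrArg (suspend _) (S.eta_app hn hz)).trans hz

theorem eq_eta (hn : 1 ≤ n) {η : (GrMod.shift (-(n : ℤ))).obj M ⟶ (gradedHom N).obj (S.Y n)}
    (hη : S.IsInduced η) : η = S.eta hn := by
  ext i m
  obtain ⟨z, y, hz, rfl⟩ := S.exists_lift_isImage i m
  refine Eq.trans ?_ (S.eta_app hn hz).symm
  exact (suspend_bijective (show i + (n : ℤ) = i - -(n : ℤ) by omega)).1
    ((hη i y _ rfl).trans hz.symm)

/-- Exactness at `Y_n` and injectivity of `η` are the two parts of `isImage_aux`. At `X_n`, the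
image of `π_n` lies between the image of `d_{n+1}` and the kernel of `d_n`, and these coincide. -/
theorem isExact_seq_eta (hn : 1 ≤ n) : (S.seq (S.eta hn)).IsExact where
  aug_surjective := S.aug_surjective
  exact_E i hi := S.exact i (by omega)
  exact_top := by
    obtain ⟨n, rfl⟩ := Nat.exists_eq_add_one.2 hn
    intro k x
    refine (S.exact (n + 1) (by omega) k x).trans ⟨?_, ?_⟩
    · rintro ⟨y, rfl⟩
      exact ⟨(show N⟦k⟧ ⟶ S.X (n + 2) from y) ≫ S.iota (n + 1), Category.assoc _ _ _⟩
    · rintro ⟨y, rfl⟩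
      refine (S.exact (n + 1) (by omega) k _).1 ?_
      change ((show N⟦k⟧ ⟶ S.Y (n + 1) from y) ≫ S.pi (n + 1)) ≫ S.iota n ≫ S.pi n = 0
      rw [Category.assoc, reassoc_of% S.pi_iota (show n + 1 < n + 1 + 1 by omega), zero_comp,
        comp_zero]
  exact_P k z := by
    refine (S.comp_pi_eq_zero_iff_exists_isImage hn (Nat.lt_succ_self n)
      (show k + (n : ℤ) = k - -(n : ℤ) by omega) z).trans ⟨?_, ?_⟩
    · rintro ⟨y, hy⟩
      exact ⟨_, S.eta_app hn hy⟩
    · rintro ⟨m, rfl⟩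
      obtain ⟨z, y, hz, rfl⟩ := S.exists_lift_isImage k m
      exact ⟨y, (congrArg (suspend _) (S.eta_app hn hz)).trans hz⟩
  inc_injective k := by
    refine (injective_iff_map_eq_zero _).2 fun m hm => ?_
    obtain ⟨z, y, hz, rfl⟩ := S.exists_lift_isImage k m
    exact (S.eq_zero_iff_of_isImage hn (Nat.lt_succ_self n) _ hz).1 ((S.eta_app hn hz).symm.trans hm)

/-- The obstruction extension of a Postnikov system. -/
noncomputable def obstruction (hn : 1 ≤ n) : YExtension n M ((GrMod.shift (-(n : ℤ))).obj M) where
  toYSeq := S.seq (S.eta hn)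
  exact := S.isExact_seq_eta hn

theorem isObstructionClass_iff (hn : 1 ≤ n) (ξ : YExt n M ((GrMod.shift (-(n : ℤ))).obj M)) :
    S.IsObstructionClass ξ ↔ ξ = (S.obstruction hn).toExt := by
  constructor
  · rintro ⟨η, hη, h, rfl⟩
    obtain rfl := S.eq_eta hn hη
    rfl
  · rintro rfl
    exact ⟨_, S.isInduced_eta hn, S.isExact_seq_eta hn, rfl⟩

end PostnikovSystem

end Triangulated

/-! ### Morphisms of Postnikov systems and invariance of the obstruction class. -/

section Triangulated

variable {C : Type u} [Category.{v} C]

/-- A map out of a coproduct lifts as soon as its components do. -/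
theorem exists_lift_of_isColimit_cofan {J : Type*} {A : J → C} {X Y Z : C} (inj : ∀ i, A i ⟶ X)
    (h : IsColimit (Cofan.mk X inj)) (φ : X ⟶ Y) (ι : Z ⟶ Y)
    (hφ : ∀ i, ∃ x, inj i ≫ φ = x ≫ ι) : ∃ f : X ⟶ Z, f ≫ ι = φ := by
  choose x hx using hφ
  refine ⟨Cofan.IsColimit.desc h x, Cofan.IsColimit.hom_ext h _ _ fun i => ?_⟩
  exact (Category.assoc _ _ _).symm.trans ((congrArg (· ≫ ι) (Cofan.IsColimit.fac h x i)).trans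
    (hx i).symm)

variable [Preadditive C]

/-- A finite coproduct in a preadditive category is a biproduct: the identity is a sum of
idempotents. -/
theorem exists_projections {m : ℕ} {X : C} {A : Fin m → C} (inj : ∀ i, A i ⟶ X)
    (h : IsColimit (Cofan.mk X inj)) : ∃ pr : ∀ i, X ⟶ A i, ∑ i, pr i ≫ inj i = 𝟙 X := by
  classical
  refine ⟨fun i => Cofan.IsColimit.desc h fun j => if e : j = i then eqToHom (congrArg A e) else 0,
    Cofan.IsColimit.hom_ext h _ _ fun j => ?_⟩
  rw [Preadditive.comp_sum, Finset.sum_eq_single j]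
  · have := Cofan.IsColimit.fac h
      (fun k => if e : k = j then eqToHom (congrArg A e) else 0) j
    rw [dif_pos rfl] at this
    exact (Category.assoc _ _ _).symm.trans ((congrArg (· ≫ inj j) this).trans
      ((Category.id_comp _).trans (Category.comp_id _).symm))
  · intro i _ hi
    have := Cofan.IsColimit.fac h
      (fun k => if e : k = i then eqToHom (congrArg A e) else 0) j
    rw [dif_neg (Ne.symm hi)] at this
    exact (Category.assoc _ _ _).symm.trans ((congrArg (· ≫ inj i) this).trans zero_comp)
  · simp

variable [HasShift C ℤ] [∀ n : ℤ, (shiftFunctor C n).Additive]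

/-- Module maps out of `T(N, X)_*` are determined by their values on the summands of `X`. -/
theorem gradedHom_hom_ext {N X : C} {m : ℕ} {d : Fin m → ℤ} (inj : ∀ i, N⟦d i⟧ ⟶ X)
    (h : IsColimit (Cofan.mk X inj)) {B : GrMod (endRing N)} {f g : (gradedHom N).obj X ⟶ B}
    (hfg : ∀ i, f.app (d i) (inj i) = g.app (d i) (inj i)) : f = g := by
  obtain ⟨pr, hpr⟩ := exists_projections inj h
  ext k x
  -- Each component `N[k] ⟶ N[d i]` is the suspension of an element of `Λ`, which exhibits `x` as a
  -- combination of the `inj i`.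
  have hx : ∀ i, ∃ a : N⟦k - d i⟧ ⟶ N, suspend (sub_add_cancel k (d i)) a =
      (show N⟦k⟧ ⟶ X from x) ≫ pr i := fun i => (suspend_bijective _).2 _
  choose a ha using hx
  have e : (show N⟦k⟧ ⟶ X from x) =
      ∑ i, shiftedComp (add_sub_cancel (d i) k) (inj i) (a i) := by
    conv_lhs => rw [← Category.comp_id (show N⟦k⟧ ⟶ X from x), ← hpr, Preadditive.comp_sum]
    refine Finset.sum_congr rfl fun i _ => ?_
    rw [← Category.assoc, ← ha]
    exact Category.assoc _ _ _
  have key : ∀ f : (gradedHom N).obj X ⟶ B, f.app k x =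
      ∑ i, B.smul (add_sub_cancel (d i) k) (f.app (d i) (inj i)) (a i) := by
    intro f
    refine (congrArg (f.app k) e).trans ?_
    refine (map_sum (f.app k) (fun i => (shiftedComp (add_sub_cancel (d i) k) (inj i) (a i) :
      ((gradedHom N).obj X).carrier k)) Finset.univ).trans ?_
    exact Finset.sum_congr rfl fun i _ => f.map_smul _ _ _
  rw [key f, key g]
  exact Finset.sum_congr rfl fun i _ => by rw [hfg]

variable [HasZeroObject C] [Pretriangulated C]

namespace PostnikovSystem

variable {N : C} {M : GrMod (endRing N)} {n : ℕ} (S₀ S : PostnikovSystem N M (n + 1))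

/-- Sparseness of `M` makes maps `N[i] ⟶ Y_j` with `n ∣ i` and `0 < j < n` factor over
`X_{j + 1}`. -/
theorem exists_lift_iota (hM : IsSparse n M.carrier) {j : ℕ} (hj : j + 2 ≤ n) {i : ℤ}
    (hi : (n : ℤ) ∣ i) (w : N⟦i⟧ ⟶ S.Y (j + 1)) : ∃ x, w = x ≫ S.iota (j + 1) := by
  obtain ⟨x, hx⟩ := (S.exact_succ (show j + 1 < n + 1 by omega) (w ≫ S.pi (j + 1))).1 (by
    rw [Category.assoc, reassoc_of% S.pi_iota (show j + 1 < n + 1 by omega), zero_comp, comp_zero])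
  obtain ⟨y, hy⟩ := (S.comp_pi_eq_zero_iff_exists_isImage (Nat.succ_pos j) (by omega) rfl
    (w - x ≫ S.iota (j + 1))).1 (by rw [Preadditive.sub_comp, Category.assoc, hx, sub_self])
  have : Subsingleton (M.carrier (i + (j + 1 : ℕ))) := hM _ (by
    rw [dvd_add_right hi]
    exact_mod_cast Nat.not_dvd_of_pos_of_lt (Nat.succ_pos j) (by omega))
  refine ⟨x, sub_eq_zero.1 ?_⟩
  exact (S.eq_zero_iff_of_isImage (Nat.succ_pos j) (by omega) rfl hy).2 (Subsingleton.elim _ _)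

/-- A morphism of Postnikov systems over the identity of `M`. -/
structure Map where
  f : ∀ j, S₀.X j ⟶ S.X j
  g : ∀ j, S₀.Y j ⟶ S.Y j
  comm_aug : ∀ (i : ℤ) (x : N⟦i⟧ ⟶ S₀.X 0), S.augHom i (x ≫ f 0) = S₀.augHom i x
  comm_pi : ∀ j, j ≤ n → g j ≫ S.pi j = S₀.pi j ≫ f j
  comm_iota : ∀ j, j + 1 ≤ n → f (j + 1) ≫ S.iota j = S₀.iota j ≫ g j
  comm_alpha : ∀ j, j + 1 ≤ n → g j ≫ S.alpha j = S₀.alpha j ≫ (g (j + 1))⟦(1 : ℤ)⟧'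

/-- The map is built upwards: lift `X_{j+1}` over `ι` summand by summand, then complete the morphism
of triangles to get `Y_{j+1}`. Only the source has to be finite free on shifts divisible by `n`; the
target is arbitrary. -/
theorem nonempty_map (hX : ∀ j, j ≤ n → IsFinNFree n N (S₀.X j)) (hM : IsSparse n M.carrier) :
    Nonempty (Map S₀ S) := by
  have := S.isIso_pi_zero
  obtain ⟨f₀, hf₀⟩ : ∃ f : S₀.X 0 ⟶ S.X 0, (gradedHom N).map f ≫ S.aug = S₀.aug := by
    obtain ⟨m, d, inj, -, ⟨h⟩⟩ := hX 0 (Nat.zero_le _)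
    choose x hx using fun i => S.augHom_surjective _ (S₀.augHom _ (inj i))
    refine ⟨Cofan.IsColimit.desc h x, gradedHom_hom_ext inj h fun i => ?_⟩
    exact (congrArg (S.augHom (d i)) (Cofan.IsColimit.fac h x i)).trans (hx i)
  have hf₀' : ∀ (i : ℤ) (x : N⟦i⟧ ⟶ S₀.X 0), S.augHom i (x ≫ f₀) = S₀.augHom i x := fun i x =>
    congrArg (fun φ => φ.app i x) hf₀
  -- The second condition records that the next lift exists. It comes from compatibility with the
  -- augmentation for `j = 0` and from sparseness for `0 < j < n`; beyond `n` the data are set to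
  -- zero.
  let A : ℕ → Type v := fun j => { p : (S₀.X j ⟶ S.X j) × (S₀.Y j ⟶ S.Y j) //
    j ≤ n → p.2 ≫ S.pi j = S₀.pi j ≫ p.1 ∧ (j + 1 ≤ n → ∀ (i : ℤ), (n : ℤ) ∣ i →
      ∀ z : N⟦i⟧ ⟶ S₀.X (j + 1), ∃ x, z ≫ S₀.iota j ≫ p.2 = x ≫ S.iota j) }
  let a : A 0 := ⟨(f₀, S₀.pi 0 ≫ f₀ ≫ inv (S.pi 0)), fun _ => ⟨by simp, fun hn i _ z => by
    obtain ⟨x, hx⟩ := (S.exact_zero (Nat.succ_pos n) (z ≫ S₀.iota 0 ≫ S₀.pi 0 ≫ f₀)).1 (by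
      have h := hf₀' i (z ≫ S₀.iota 0 ≫ S₀.pi 0)
      rw [(S₀.exact_zero (Nat.succ_pos n) _).2 ⟨z, rfl⟩] at h
      simpa using h)
    refine ⟨x, ?_⟩
    rw [← cancel_mono (S.pi 0)]
    simpa using hx.symm⟩⟩
  obtain ⟨s, hs₀, hs⟩ := exists_seq_of_forall_exists (A := A)
    (fun j p q => j + 1 ≤ n → q.1.1 ≫ S.iota j = S₀.iota j ≫ p.1.2 ∧
      p.1.2 ≫ S.alpha j = S₀.alpha j ≫ (q.1.2)⟦(1 : ℤ)⟧') a (by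
    rintro j ⟨⟨f, g⟩, hfg⟩
    by_cases hj : j + 1 ≤ n
    · obtain ⟨hπ, hl⟩ := hfg (by omega)
      obtain ⟨m, d, inj, hd, ⟨h⟩⟩ := hX (j + 1) hj
      obtain ⟨f', hf'⟩ := exists_lift_of_isColimit_cofan inj h (S₀.iota j ≫ g) (S.iota j)
        fun i => hl hj (d i) (hd i) (inj i)
      obtain ⟨g', h₁, h₂⟩ := complete_distinguished_triangle_morphism₁ _ _
        (S₀.distinguished j (by omega)) (S.distinguished j (by omega)) f' g hf'.symm
      refine ⟨⟨(f', g'), fun _ => ⟨h₁.symm, fun hj' i hi z => ?_⟩⟩, fun _ => ⟨hf', h₂.symm⟩⟩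
      exact S.exists_lift_iota hM hj' hi _
    · exact ⟨⟨(0, 0), fun h => absurd h hj⟩, fun h => absurd h hj⟩)
  refine ⟨⟨fun j => (s j).1.1, fun j => (s j).1.2, ?_, fun j hj => ((s j).2 hj).1,
    fun j hj => (hs j hj).1, fun j hj => (hs j hj).2⟩⟩
  rw [hs₀]
  exact hf₀'

variable {S₀ S}

theorem Map.alphaComp_comp (φ : Map S₀ S) {j : ℕ} (hj : j ≤ n) :
    S₀.alphaComp j ≫ (φ.g j)⟦(j : ℤ)⟧' = φ.g 0 ≫ S.alphaComp j := by
  induction j with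
  | zero => exact ((shiftFunctorZero C ℤ).inv.naturality (φ.g 0)).symm
  | succ j ih =>
    have e := (shiftFunctorAdd' C (1 : ℤ) (j : ℤ) ((j + 1 : ℕ) : ℤ)
      (by push_cast; ring)).inv.naturality (φ.g (j + 1))
    simp only [Functor.comp_map] at e
    rw [alphaComp, alphaComp, ← reassoc_of% ih (by omega), Category.assoc, Category.assoc, ← e,
      ← Functor.map_comp_assoc, ← Functor.map_comp_assoc, φ.comm_alpha j hj]

theorem Map.obstruction_toExt_eq (φ : Map S₀ S) (hn : 1 ≤ n) :
    (S₀.obstruction hn).toExt = (S.obstruction hn).toExt := by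
  refine Quot.sound ⟨
    { f := fun i _ => (gradedHom N).map (φ.f i)
      fP := (gradedHom N).map (φ.g n)
      comm_aug := ?_
      comm_d := fun i hi => ?_
      comm_top := ?_
      comm_inc := ?_ }⟩
  · ext i x
    exact φ.comm_aug i x
  · refine ((gradedHom N).map_comp _ _).symm.trans
      (Eq.trans (congrArg (gradedHom N).map ?_) ((gradedHom N).map_comp _ _))
    rw [← Category.assoc, φ.comm_iota i hi, Category.assoc, Category.assoc, φ.comm_pi i (by omega)]
  · exact ((gradedHom N).map_comp _ _).symm.trans
      ((congrArg (gradedHom N).map (φ.comm_pi n le_rfl)).trans ((gradedHom N).map_comp _ _))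
  · ext i m
    obtain ⟨z, y, hz, rfl⟩ := S₀.exists_lift_isImage i m
    have hz' : S.IsImage n (by omega) (z ≫ φ.g n) (y ≫ φ.g 0) := by
      unfold IsImage at hz ⊢
      rw [suspend_comp, hz, Category.assoc, φ.alphaComp_comp le_rfl, Category.assoc]
    have e := S.eta_app hn hz'
    rw [Category.assoc, φ.comm_pi 0 (by omega), ← Category.assoc, φ.comm_aug] at e
    exact (congrArg (fun w : N⟦i⟧ ⟶ S₀.Y n => w ≫ φ.g n) (S₀.eta_app hn hz)).trans e.symm

end PostnikovSystem

end Triangulated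

/-! ### From a filtered object to a Postnikov tower. -/

/-- A map out of a term of a sequence restricts to the previous terms. -/
theorem exists_restriction_of_seq {C : Type u} [Category.{v} C] [HasZeroMorphisms C]
    {F : ℕ → C} (i : ∀ j, F j ⟶ F (j + 1)) (m : ℕ) {A : C} (g : F m ⟶ A) :
    ∃ q : ∀ j, F j ⟶ A, q m = g ∧ ∀ j, j < m → i j ≫ q (j + 1) = q j := by
  induction m with
  | zero =>
    classical
    exact ⟨Function.update (fun _ => 0) 0 g, Function.update_self .., fun j hj =>
      absurd hj (Nat.not_lt_zero j)⟩
  | succ m ih =>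
    classical
    obtain ⟨q, hq, hq'⟩ := ih (i m ≫ g)
    refine ⟨Function.update q (m + 1) g, Function.update_self .., fun j hj => ?_⟩
    rw [Function.update_of_ne (show j ≠ m + 1 by omega)]
    rcases Nat.lt_succ_iff_lt_or_eq.1 hj with h | rfl
    · rw [Function.update_of_ne (show j + 1 ≠ m + 1 by omega), hq' j h]
    · rw [Function.update_self, hq]

section Triangulated

variable {C : Type u} [Category.{v} C] [Preadditive C] [HasShift C ℤ]

/-- Desuspension of a tower `W_0 ⟶ W_1 ⟶ ⋯` under `X_0` with cofibres `X_{j+1}[j + 1]`. -/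
theorem exists_desuspension {X W : ℕ → C} (a : ∀ j, X 0 ⟶ W j) [IsIso (a 0)]
    (m₁ : ∀ j : ℕ, (X (j + 1))⟦(j : ℤ)⟧ ⟶ W j) (m₃ : ∀ j, W j ⟶ W (j + 1))
    (w : ∀ j : ℕ, W (j + 1) ⟶ (X (j + 1))⟦(j : ℤ)⟧⟦(1 : ℤ)⟧) :
    ∃ (Y : ℕ → C) (pi : ∀ j, Y j ⟶ X j) (iota : ∀ j, X (j + 1) ⟶ Y j)
      (alpha : ∀ j, Y j ⟶ (Y (j + 1))⟦(1 : ℤ)⟧) (u : ∀ j : ℕ, (Y j)⟦(j : ℤ)⟧ ≅ W j),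
      pi 0 = (shiftFunctorZero C ℤ).inv.app (Y 0) ≫ (u 0).hom ≫ inv (a 0) ∧
      (∀ j : ℕ, (iota j)⟦(j : ℤ)⟧' ≫ (u j).hom = m₁ j) ∧
      (∀ j : ℕ, (alpha j)⟦(j : ℤ)⟧' ≫ (shiftFunctorAdd' C (1 : ℤ) (j : ℤ) ((j + 1 : ℕ) : ℤ)
        (by push_cast; ring)).inv.app _ ≫ (u (j + 1)).hom = (u j).hom ≫ m₃ j) ∧
      (∀ j : ℕ, (pi (j + 1))⟦((j + 1 : ℕ) : ℤ)⟧' ≫ (shiftFunctorAdd' C (j : ℤ) (1 : ℤ)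
        ((j + 1 : ℕ) : ℤ) (by push_cast; ring)).hom.app _ =
          ((j + 1 : ℕ) : ℤ).negOnePow • ((u (j + 1)).hom ≫ w j)) := by
  let u : ∀ j : ℕ, (W j)⟦(-j : ℤ)⟧⟦(j : ℤ)⟧ ≅ W j := fun j =>
    (shiftFunctorCompIsoId C (-j : ℤ) (j : ℤ) (by omega)).app (W j)
  refine ⟨fun j => (W j)⟦(-j : ℤ)⟧, fun j => match j with
    | 0 => (shiftFunctorZero C ℤ).inv.app _ ≫ (u 0).hom ≫ inv (a 0)
    -- The sign `(-1)^{j+1}` is the one that `distinguished_of_shift_rotate` needs; it is the source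
    -- of the signs in the differentials.
    | j + 1 => (shiftFunctor C ((j + 1 : ℕ) : ℤ)).preimage (((j + 1 : ℕ) : ℤ).negOnePow •
      ((u (j + 1)).hom ≫ w j) ≫ (shiftFunctorAdd' C (j : ℤ) (1 : ℤ) ((j + 1 : ℕ) : ℤ)
        (by push_cast; ring)).inv.app _),
    fun j => (shiftFunctor C (j : ℤ)).preimage (m₁ j ≫ (u j).inv),
    fun j => (shiftFunctor C (j : ℤ)).preimage ((u j).hom ≫ m₃ j ≫ (u (j + 1)).inv ≫
      (shiftFunctorAdd' C (1 : ℤ) (j : ℤ) ((j + 1 : ℕ) : ℤ) (by push_cast; ring)).hom.app _),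
    u, rfl, fun j => ?_, fun j => ?_, fun j => ?_⟩
  · simp
  · rw [Functor.map_preimage]
    simp
  · rw [Functor.map_preimage]
    simp

variable [∀ n : ℤ, (shiftFunctor C n).Additive] [HasZeroObject C] [Pretriangulated C]

/-- A triangle is distinguished if its rotation becomes distinguished after a shift, with the sign
that the shift introduces. -/
theorem distinguished_of_shift_rotate {A B B' : C} (ι : A ⟶ B) (α : B ⟶ B'⟦(1 : ℤ)⟧) (π : B' ⟶ A)
    (j k : ℤ) (hk : j + 1 = k) (ρ : B'⟦k⟧ ⟶ A⟦j⟧⟦(1 : ℤ)⟧)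
    (h : Triangle.mk (ι⟦j⟧') (α⟦j⟧' ≫ (shiftFunctorAdd' C 1 j k (by omega)).inv.app B') ρ ∈
      distTriang C)
    (hπ : π⟦k⟧' ≫ (shiftFunctorAdd' C j 1 k hk).hom.app A = k.negOnePow • ρ) :
    Triangle.mk π ι α ∈ distTriang C := by
  rw [Pretriangulated.rotate_distinguished_triangle, ← Triangle.shift_distinguished_iff _ j]
  -- Shifting a triangle by `j` multiplies its three maps by `(-1)^j`, and rotating negates `π[1]`.
  -- The automorphism `(-1)^j` of the middle object clears the first two signs and leaves
  -- `(-1)^{j+1} = (-1)^k` on the third map.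
  let E : B⟦j⟧ ≅ B⟦j⟧ :=
    { hom := j.negOnePow • 𝟙 _
      inv := j.negOnePow • 𝟙 _
      hom_inv_id := by
        rw [Linear.units_smul_comp, Linear.comp_units_smul, smul_smul, Category.comp_id,
          Int.units_mul_self, one_smul]
      inv_hom_id := by
        rw [Linear.units_smul_comp, Linear.comp_units_smul, smul_smul, Category.comp_id,
          Int.units_mul_self, one_smul] }
  refine isomorphic_distinguished _ h _ (Iso.symm ?_)
  refine Triangle.isoMk (Triangle.mk _ _ _) ((Triangle.shiftFunctor C j).obj
    (Triangle.mk π ι α).rotate) (Iso.refl (A⟦j⟧)) E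
    ((shiftFunctorAdd' C 1 j k (by omega)).symm.app B').symm ?_ ?_ ?_
  · change ι⟦j⟧' ≫ (j.negOnePow • 𝟙 _) = 𝟙 _ ≫ (j.negOnePow • ι⟦j⟧')
    rw [Linear.comp_units_smul, Category.comp_id, Category.id_comp]
  · change (α⟦j⟧' ≫ (shiftFunctorAdd' C 1 j k (by omega)).inv.app B') ≫
      (shiftFunctorAdd' C 1 j k (by omega)).hom.app B' = (j.negOnePow • 𝟙 _) ≫ (j.negOnePow • α⟦j⟧')
    rw [Category.assoc, Iso.inv_hom_id_app, Linear.units_smul_comp, Linear.comp_units_smul,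
      smul_smul, Int.units_mul_self, one_smul, Category.id_comp]
    exact Category.comp_id _
  · change ρ ≫ (𝟙 (A⟦j⟧))⟦(1 : ℤ)⟧' = (shiftFunctorAdd' C 1 j k (by omega)).hom.app B' ≫
      (j.negOnePow • (-(π⟦(1 : ℤ)⟧'))⟦j⟧' ≫ (shiftFunctorComm C 1 j).hom.app A)
    have nat := (shiftFunctorAdd' C 1 j k (by omega)).hom.naturality π
    simp only [Functor.comp_map] at nat
    rw [CategoryTheory.Functor.map_id, Category.comp_id, shiftFunctorComm_eq C 1 j k (by omega)]
    simp only [Functor.map_neg, Iso.trans_hom, Iso.symm_hom, NatTrans.comp_app,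
      Linear.comp_units_smul, Preadditive.neg_comp, Preadditive.comp_neg]
    have hjk : k.negOnePow = -j.negOnePow := by rw [← hk, Int.negOnePow_succ]
    rw [← reassoc_of% nat, Iso.hom_inv_id_app_assoc, hπ, hjk]
    rcases Int.units_eq_one_or j.negOnePow with e | e <;> simp [e]

namespace FilteredObject

variable {X : ℕ → C} {lam : ∀ j, X (j + 1) ⟶ X j} {m : ℕ} (Z : FilteredObject X lam m)

theorem incl_comp {A : C} {j : ℕ} (q : ∀ j, Z.F j ⟶ A)
    (hq : ∀ j, j < m → Z.i j ≫ q (j + 1) = q j) (hj : j < m) : Z.incl j ≫ q (j + 1) = q 1 := by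
  induction j with
  | zero => exact Category.id_comp _
  | succ j ih =>
    rw [incl, Category.assoc, hq _ hj, ih (by omega)]

end FilteredObject

variable [IsTriangulated C]

/-- The cones `W_j` of the restrictions `F_j ⟶ A` of a map `g : F_m ⟶ A` out of a filtered object,
with the triangles `X_j[j] ⟶ W_j ⟶ W_{j+1} ⟶ X_j[j][1]`. -/
theorem FilteredObject.exists_cones {X : ℕ → C} {lam : ∀ j, X (j + 1) ⟶ X j} {m : ℕ}
    (Z : FilteredObject X lam m) {A : C} (g : Z.F m ⟶ A) :
    ∃ (W : ℕ → C) (q : ∀ j, Z.F j ⟶ A) (a : ∀ j, A ⟶ W j) (b : ∀ j, W j ⟶ (Z.F j)⟦(1 : ℤ)⟧)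
      (m₁ : ∀ j : ℕ, (X j)⟦(j : ℤ)⟧ ⟶ W j) (m₃ : ∀ j, W j ⟶ W (j + 1)),
      q m = g ∧ (∀ j, j < m → Z.i j ≫ q (j + 1) = q j) ∧ IsIso (a 0) ∧
      ∀ j : ℕ, j < m → Z.p j ≫ m₁ j = q (j + 1) ≫ a j ∧ m₁ j ≫ b j = Z.d j ∧
        a j ≫ m₃ j = a (j + 1) ∧
        Triangle.mk (m₁ j) (m₃ j) (b (j + 1) ≫ (Z.p j)⟦(1 : ℤ)⟧') ∈ distTriang C := by
  obtain ⟨q, hq, hq'⟩ := exists_restriction_of_seq Z.i m g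
  choose W a b hW using fun j => distinguished_cocone_triangle (q j)
  have h : ∀ j : ℕ, ∃ (m₁ : (X j)⟦(j : ℤ)⟧ ⟶ W j) (m₃ : W j ⟶ W (j + 1)), j < m →
      Z.p j ≫ m₁ = q (j + 1) ≫ a j ∧ m₁ ≫ b j = Z.d j ∧ a j ≫ m₃ = a (j + 1) ∧
        Triangle.mk m₁ m₃ (b (j + 1) ≫ (Z.p j)⟦(1 : ℤ)⟧') ∈ distTriang C := by
    intro j
    by_cases hj : j < m
    · have O := Triangulated.someOctahedron (hq' j hj) (Z.distinguished j hj) (hW (j + 1)) (hW j)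
      exact ⟨O.m₁, O.m₃, fun _ => ⟨O.comm₁, O.comm₂, O.comm₃, O.mem⟩⟩
    · exact ⟨0, 0, fun h => absurd h hj⟩
  choose m₁ m₃ h using h
  exact ⟨W, q, a, b, m₁, m₃, hq, hq', (Triangle.isZero₁_iff_isIso₂ _ (hW 0)).1 Z.isZero, h⟩

end Triangulated

section Triangulated

variable {C : Type u} [Category.{v} C] [Preadditive C] [HasShift C ℤ]
  [∀ n : ℤ, (shiftFunctor C n).Additive] [HasZeroObject C] [Pretriangulated C] [IsTriangulated C]

/-- The Postnikov tower associated with a filtered object `Z ∈ {λ_2, …, λ_{n+1}}` and an extension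
`g₀` of `λ_1` to `Z`. -/
theorem FilteredObject.exists_tower {X : ℕ → C} {lam : ∀ j, X (j + 1) ⟶ X j} {n : ℕ}
    (Z : FilteredObject (fun j => X (j + 1)) (fun j => lam (j + 1)) (n + 1))
    (g₀ : Z.F (n + 1) ⟶ X 0) (h₀ : Z.sigma' ≫ g₀ = lam 0) :
    ∃ (Y : ℕ → C) (pi : ∀ j, Y j ⟶ X j) (iota : ∀ j, X (j + 1) ⟶ Y j)
      (alpha : ∀ j, Y j ⟶ (Y (j + 1))⟦(1 : ℤ)⟧),
      IsIso (pi 0) ∧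
      (∀ j, j < n + 1 → Triangle.mk (pi (j + 1)) (iota j) (alpha j) ∈ distTriang C) ∧
      (∀ j, j < n + 1 → iota j ≫ pi j = (j : ℤ).negOnePow • lam j) ∧
      ∀ (ac : ∀ j : ℕ, Y 0 ⟶ (Y j)⟦(j : ℤ)⟧), ac 0 = (shiftFunctorZero C ℤ).inv.app (Y 0) →
        (∀ j, ac (j + 1) = ac j ≫ (alpha j)⟦(j : ℤ)⟧' ≫ (shiftFunctorAdd' C (1 : ℤ) (j : ℤ)
          ((j + 1 : ℕ) : ℤ) (by push_cast; ring)).inv.app _) →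
        ∀ y, y ≫ pi 0 = g₀ → Z.sigma ≫ (iota n)⟦(n : ℤ)⟧' = y ≫ ac n := by
  obtain ⟨W, q, a, b, m₁, m₃, hq, hq', ha, h⟩ := Z.exists_cones g₀
  obtain ⟨Y, pi, iota, alpha, u, hπ₀, hι, hα, hπ⟩ :=
    exists_desuspension a m₁ m₃ fun j => b (j + 1) ≫ (Z.p j)⟦(1 : ℤ)⟧'
  refine ⟨Y, pi, iota, alpha, ?_, fun j hj => ?_, fun j hj => ?_, ?_⟩
  · rw [hπ₀]
    infer_instance
  · refine distinguished_of_shift_rotate (iota j) (alpha j) (pi (j + 1)) (j : ℤ) ((j + 1 : ℕ) : ℤ)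
      (by push_cast; ring) ((u (j + 1)).hom ≫ b (j + 1) ≫ (Z.p j)⟦(1 : ℤ)⟧') ?_ (hπ j)
    refine isomorphic_distinguished _ (h j hj).2.2.2 _
      (Triangle.isoMk (Triangle.mk _ _ _) (Triangle.mk _ _ _) (Iso.refl _) (u j) (u (j + 1))
        ?_ ?_ ?_)
    · exact (hι j).trans (Category.id_comp _).symm
    · exact (Category.assoc _ _ _).trans (hα j)
    · change (_ ≫ _) ≫ (𝟙 ((X (j + 1))⟦(j : ℤ)⟧))⟦(1 : ℤ)⟧' = _
      rw [CategoryTheory.Functor.map_id, Category.comp_id]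
      rfl
  · cases j with
    | zero =>
      have e₁ : iota 0 ≫ (shiftFunctorZero C ℤ).inv.app (Y 0) ≫ (u 0).hom =
          (shiftFunctorZero C ℤ).inv.app (X 1) ≫ m₁ 0 := by
        have nat := (shiftFunctorZero C ℤ).inv.naturality (iota 0)
        rw [← hι 0]
        exact (Category.assoc _ _ _).symm.trans ((congrArg (· ≫ (u 0).hom) nat).trans
          (Category.assoc _ _ _))
      have := Z.isIso_p_zero
      have e₂ : m₁ 0 = inv (Z.p 0) ≫ q 1 ≫ a 0 := by
        rw [IsIso.eq_inv_comp]
        exact (h 0 (Nat.succ_pos n)).1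
      -- The lowest differential is `λ_1` because `g₀` restricts to `λ_1` along `σ'`; the higher
      -- ones come from the attaching maps of the filtration.
      have e₃ : lam 0 = (shiftFunctorZero C ℤ).inv.app (X 1) ≫ inv (Z.p 0) ≫ q 1 := by
        rw [← h₀, FilteredObject.sigma', Category.assoc, Category.assoc, ← hq,
          Z.incl_comp q hq' (Nat.lt_succ_self n)]
      rw [hπ₀, reassoc_of% e₁, e₂, e₃]
      simp
    | succ j =>
      apply (shiftFunctor C ((j + 1 : ℕ) : ℤ)).map_injective
      rw [← cancel_mono ((shiftFunctorAdd' C (j : ℤ) (1 : ℤ)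
        ((j + 1 : ℕ) : ℤ) (by push_cast; ring)).hom.app (X (j + 1))), Functor.map_comp,
        Category.assoc, hπ, Linear.comp_units_smul, ← Category.assoc, hι, ← Category.assoc,
        (h (j + 1) hj).2.1, Z.comm j hj, Functor.map_units_smul, Linear.units_smul_comp]
  · intro ac hac₀ hac y hy
    -- `ac` stands for the `alphaComp` of a system not yet assembled. Under `Y_j[j] ≅ W_j` the
    -- composite `α_j ⋯ α_1` becomes the structure map `X_0 ⟶ W_j`, so both sides of the claim
    -- become `g₀ ≫ a n`.
    have key : ∀ j, j ≤ n → ac j ≫ (u j).hom = pi 0 ≫ a j := by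
      intro j hj
      induction j with
      | zero =>
        rw [hac₀, hπ₀]
        simp
      | succ j ih =>
        rw [hac, Category.assoc, Category.assoc, hα, ← Category.assoc, ih (by omega),
          Category.assoc, (h j (by omega)).2.2.1]
    rw [← cancel_mono (u n).hom, Category.assoc, Category.assoc, hι, key n le_rfl, reassoc_of% hy,
      ← hq]
    exact (h n (Nat.lt_succ_self n)).1

end Triangulated

/-! ### Factorizations and the accumulated signs. -/

section GradedModules

variable {Λ : GrRing.{v}}

/-- A map whose values lie in the image of an injective map factors through it. -/
theorem GrMod.exists_factor {A B P : GrMod Λ} (φ : A ⟶ P) (ι : B ⟶ P)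
    (hι : ∀ k, Function.Injective (ι.app k)) (h : ∀ k x, ∃ y, ι.app k y = φ.app k x) :
    ∃ τ : A ⟶ B, τ ≫ ι = φ := by
  choose t ht using h
  refine ⟨{ app := fun k => AddMonoidHom.mk' (t k) fun x y => hι k ?_
            map_smul := fun {i j k} h x a => hι k ?_ }, GrMod.hom_ext ht⟩
  · rw [ht, map_add, map_add, ht, ht]
  · change ι.app k (t k _) = ι.app k (B.smul h (t i x) a)
    rw [ht, φ.map_smul, ι.map_smul, ht]

theorem FreeResolution.isSparse {n : ℕ} {M : GrMod Λ} (R : FreeResolution n M) :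
    IsSparse n M.carrier := fun k hk =>
  haveI := (R.F 0).property.2 k hk
  (R.aug_surjective k).subsingleton

/-- The sign `(-1)^{i(i-1)/2}`. -/
def alternatingSign : ℕ → ℤ
  | 0 => 1
  | i + 1 => ((i : ℤ).negOnePow : ℤ) * alternatingSign i

theorem alternatingSign_succ (n : ℕ) :
    alternatingSign (n + 1) = (-1) ^ (n * (n + 1) / 2) := by
  induction n with
  | zero => simp [alternatingSign]
  | succ n ih =>
    rw [alternatingSign, ih, Int.coe_negOnePow_natCast, ← pow_add]
    congr 1
    have : (n + 1) * (n + 1 + 1) = n * (n + 1) + (n + 1) * 2 := by ring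
    rw [this, Nat.add_mul_div_right _ _ (by norm_num)]
    ring

/-- This makes the rescaled identities commute with differentials that differ by `(-1)^n`. -/
theorem alternatingSign_mul (n : ℕ) :
    alternatingSign (n + 1) * ((n : ℤ).negOnePow : ℤ) = alternatingSign n := by
  rw [alternatingSign, mul_right_comm, ← Units.val_mul, ← Int.negOnePow_add,
    Int.negOnePow_even _ ⟨_, rfl⟩]
  simp

end GradedModules

/-! ### The Postnikov system of a resolution and its comparison with the cup product. -/

section Triangulated

variable {C : Type u} [Category.{v} C] [HasShift C ℤ]

theorem IsFinNFree.isNFree {n : ℕ} {N X : C} (h : IsFinNFree n N X) : IsNFree N X := by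
  obtain ⟨m, d, inj, -, ⟨h⟩⟩ := h
  refine ⟨ULift.{v} (Fin m), fun i => d i.down, fun i => inj i.down, ⟨?_⟩⟩
  exact Cofan.IsColimit.mk _
    (fun t => h.desc (Cofan.mk t.pt fun i => t.inj ⟨i⟩))
    (fun t i => h.fac (Cofan.mk t.pt fun i => t.inj ⟨i⟩) ⟨i.down⟩)
    (fun t f hf => h.hom_ext fun ⟨i⟩ =>
      (hf ⟨i⟩).trans (h.fac (Cofan.mk t.pt fun i => t.inj ⟨i⟩) ⟨i⟩).symm)

variable [Preadditive C] [∀ n : ℤ, (shiftFunctor C n).Additive]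

instance (N : C) : (gradedHom N).Additive where
  map_add {X _} f g := GrMod.hom_ext fun k x =>
    Preadditive.comp_add _ _ _ (show N⟦k⟧ ⟶ X from x) f g

variable [HasZeroObject C] [Pretriangulated C]

namespace PostnikovSystem

/-- A tower whose differentials agree up to sign with the lifts of a free resolution is a
Postnikov system. -/
def ofResolution {N : C} {n : ℕ} {M : GrMod (endRing N)} (R : FreeResolution n M) {X : ℕ → C}
    (hX : ∀ j, IsFinNFree n N (X j)) (lam : ∀ j, X (j + 1) ⟶ X j)
    (e : ∀ j, (gradedHom N).obj (X j) ≅ (R.F j).obj)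
    (he : ∀ j, (gradedHom N).map (lam j) ≫ (e j).hom = (e (j + 1)).hom ≫ (R.d j).hom)
    {Y : ℕ → C} (pi : ∀ j, Y j ⟶ X j) (iota : ∀ j, X (j + 1) ⟶ Y j)
    (alpha : ∀ j, Y j ⟶ (Y (j + 1))⟦(1 : ℤ)⟧) (hpi : IsIso (pi 0)) {k : ℕ}
    (dist : ∀ j, j + 1 < k → Triangle.mk (pi (j + 1)) (iota j) (alpha j) ∈ distTriang C)
    (comp : ∀ j, j < k → iota j ≫ pi j = (j : ℤ).negOnePow • lam j) :
    PostnikovSystem N M k where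
  X := X
  Y := Y
  pi := pi
  iota := iota
  alpha := alpha
  isIso_pi_zero := hpi
  distinguished := dist
  free j _ := (hX j).isNFree
  aug := (e 0).hom ≫ R.aug
  aug_surjective i m := by
    obtain ⟨x, rfl⟩ := R.aug_surjective i m
    exact ⟨(e 0).inv.app i x, congrArg (fun φ => (φ ≫ R.aug).app i x) (e 0).inv_hom_id⟩
  exact := by
    -- The differentials agree with those of the resolution up to a unit, which changes neither
    -- kernels nor images.
    have key : ∀ j, j < k → ∃ s : ℤ, s * s = 1 ∧
        (gradedHom N).map (iota j ≫ pi j) = s • ((e (j + 1)).hom ≫ (R.d j).hom ≫ (e j).inv) := by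
      intro j hj
      refine ⟨((j : ℤ).negOnePow : ℤ), ?_, ?_⟩
      · rw [← Units.val_mul, ← Int.negOnePow_add, Int.negOnePow_even _ ⟨_, rfl⟩]
        rfl
      · rw [comp j hj, Units.smul_def, Functor.map_zsmul, ← reassoc_of% he j, Iso.hom_inv_id,
          Category.comp_id]
    have hom_inv : ∀ j i (x : (R.F j).obj.carrier i), (e j).hom.app i ((e j).inv.app i x) = x :=
      fun j i x => congrArg (fun φ => φ.app i x) (e j).inv_hom_id
    have inv_hom : ∀ j i (x : ((gradedHom N).obj (X j)).carrier i),
        (e j).inv.app i ((e j).hom.app i x) = x :=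
      fun j i x => congrArg (fun φ => φ.app i x) (e j).hom_inv_id
    intro j hj i x
    have image : (∃ y, ((gradedHom N).map (iota j ≫ pi j)).app i y = x) ↔
        ∃ y, (R.d j).hom.app i y = (e j).hom.app i x := by
      obtain ⟨s, hs, h⟩ := key j hj
      rw [h]
      constructor
      · rintro ⟨y, rfl⟩
        refine ⟨s • (e (j + 1)).hom.app i y, ?_⟩
        rw [GrMod.zsmul_app, map_zsmul, map_zsmul]
        exact congrArg (s • ·) (hom_inv j i _).symm
      · rintro ⟨y, hy⟩
        refine ⟨s • (e (j + 1)).inv.app i y, ?_⟩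
        rw [GrMod.zsmul_app, map_zsmul, smul_smul, hs, one_smul]
        change (e j).inv.app i ((R.d j).hom.app i ((e (j + 1)).hom.app i _)) = x
        rw [hom_inv, hy, inv_hom]
    refine Iff.trans ?_ ((R.exact j i _).trans image.symm)
    cases j with
    | zero => exact Iff.rfl
    | succ j =>
      obtain ⟨s, hs, h⟩ := key j (by omega)
      change ((gradedHom N).map (iota j ≫ pi j)).app i x = 0 ↔ _
      rw [h, GrMod.zsmul_app]
      change s • (e j).inv.app i ((R.d j).hom.app i ((e (j + 1)).hom.app i x)) = 0 ↔
        (R.d j).hom.app i ((e (j + 1)).hom.app i x) = 0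
      constructor
      · intro h₀
        have h₁ := congrArg (s • ·) h₀
        simp only [smul_smul, hs, one_smul, smul_zero] at h₁
        rw [← hom_inv j i ((R.d j).hom.app i _), h₁, map_zero]
      · intro h₀
        rw [h₀, map_zero, smul_zero]

/-- The product `id ∪ γ` is the obstruction class of a Postnikov system that realizes, up to signs,
the resolution and the value of `γ` on it. -/
theorem isCupProduct_iff {N : C} {n : ℕ} {M : GrMod (endRing N)}
    (S : PostnikovSystem N M (n + 1)) (hn : 1 ≤ n) (R : FreeResolution n M)
    (lam : ∀ j, S.X (j + 1) ⟶ S.X j)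
    (e : ∀ j, (gradedHom N).obj (S.X j) ≅ (R.F j).obj)
    (he : ∀ j, (gradedHom N).map (lam j) ≫ (e j).hom = (e (j + 1)).hom ≫ (R.d j).hom)
    (haug : S.aug = (e 0).hom ≫ R.aug)
    (comp : ∀ j, j < n + 1 → S.iota j ≫ S.pi j = (j : ℤ).negOnePow • lam j)
    {γ : HML (endRing N) n (n + 2) (-(n : ℤ))}
    {c : Cochain (homBimodule (endRing N) n (-(n : ℤ))) (n + 2)} (hc : NormalizedRep c γ)
    (hval : ∀ (k : ℤ) (x : N⟦k⟧ ⟶ S.X (n + 2)), ∃ y : N⟦k - -(n : ℤ)⟧ ⟶ S.Y 0,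
      S.IsImage n (by omega) (x ≫ lam (n + 1) ≫ S.iota n) y ∧
      (R.eval c).app k ((e (n + 2)).hom.app k x) = (e 0).hom.app (k - -(n : ℤ)) (y ≫ S.pi 0))
    (ξ : YExt n M ((GrMod.shift (-(n : ℤ))).obj M)) :
    IsCupProduct n (𝟙 M) γ ξ ↔ ξ = (S.obstruction hn).toExt := by
  have map_comp : ∀ j, j < n + 1 → (e (j + 1)).inv ≫ (gradedHom N).map (S.iota j ≫ S.pi j) =
      ((j : ℤ).negOnePow : ℤ) • ((R.d j).hom ≫ (e j).inv) := fun j hj => by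
    have h : (gradedHom N).map (lam j) = (e (j + 1)).hom ≫ (R.d j).hom ≫ (e j).inv := by
      rw [← reassoc_of% he j, Iso.hom_inv_id, Category.comp_id]
    rw [comp j hj, Units.smul_def, Functor.map_zsmul, h, Preadditive.comp_zsmul,
      Iso.inv_hom_id_assoc]
  have hP := (S.isExact_seq_eta hn).inc_injective
  -- On `ker λ_{n+1}` the map `ι_{n+1}` is killed by `π_n`, since `π_n ι_{n+1} = ± λ_{n+1}`; it
  -- therefore factors through the injection `η`.
  obtain ⟨τ, hτ⟩ := GrMod.exists_factor
    (GrMod.kerι (R.d n).hom ≫ (e (n + 1)).inv ≫ (gradedHom N).map (S.iota n)) (S.eta hn) hP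
    (fun k z => ((S.isExact_seq_eta hn).exact_P k _).1 (by
      have h := congrArg (fun φ => φ.app k z.1) (map_comp n (Nat.lt_succ_self n))
      rw [Functor.map_comp] at h
      refine h.trans ?_
      change (((n : ℤ).negOnePow : ℤ) • ((R.d n).hom ≫ (e n).inv)).app k z.1 = 0
      have hz : (R.d n).hom.app k z.1 = 0 := z.2
      rw [GrMod.zsmul_app, GrMod.comp_app, hz, map_zero, smul_zero]))
  rw [isCupProduct_id_iff R c hc τ ?_ ξ]
  · have : ((R.truncation n).push (((-1 : ℤ) ^ (n * (n + 1) / 2)) • τ)).toExt =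
        (S.obstruction hn).toExt := by
      refine YExtension.push_toExt (R.truncation n) (S.obstruction hn) _
        (fun i _ => alternatingSign i • (e i).inv)
        (alternatingSign (n + 1) • ((e (n + 1)).inv ≫ (gradedHom N).map (S.iota n)))
        ?_ (fun i hi => ?_) ?_ ?_
      · change ((1 : ℤ) • (e 0).inv) ≫ S.aug = R.aug
        rw [one_smul, haug, Iso.inv_hom_id_assoc]
      · change (alternatingSign (i + 1) • (e (i + 1)).inv) ≫
          (gradedHom N).map (S.iota i ≫ S.pi i) = (R.d i).hom ≫ (alternatingSign i • (e i).inv)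
        rw [Preadditive.zsmul_comp, map_comp i (by omega), smul_smul, alternatingSign_mul,
          Preadditive.comp_zsmul]
      · change (alternatingSign (n + 1) • ((e (n + 1)).inv ≫ (gradedHom N).map (S.iota n))) ≫
          (gradedHom N).map (S.pi n) = (R.d n).hom ≫ (alternatingSign n • (e n).inv)
        rw [Preadditive.zsmul_comp, Category.assoc, ← Functor.map_comp,
          map_comp n (Nat.lt_succ_self n), smul_smul, alternatingSign_mul, Preadditive.comp_zsmul]
      · change GrMod.kerι (R.d n).hom ≫ (alternatingSign (n + 1) •
          ((e (n + 1)).inv ≫ (gradedHom N).map (S.iota n))) = _ ≫ S.eta hn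
        rw [Preadditive.comp_zsmul, ← hτ, alternatingSign_succ, Preadditive.zsmul_comp]
    rw [this]
  · intro k x z hz
    obtain ⟨x, rfl⟩ : ∃ x', (e (n + 2)).hom.app k x' = x :=
      ⟨(e (n + 2)).inv.app k x, congrArg (fun φ => φ.app k x) (e (n + 2)).inv_hom_id⟩
    obtain ⟨y, hy, hy'⟩ := hval k x
    have e₁ : (R.eval c ≫ (GrMod.shift (-(n : ℤ))).map R.aug).app k ((e (n + 2)).hom.app k x) =
        S.augHom _ (y ≫ S.pi 0) := by
      refine (congrArg (R.aug.app (k - -(n : ℤ))) hy').trans ?_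
      exact (congrArg (fun φ => φ.app (k - -(n : ℤ)) (y ≫ S.pi 0)) haug).symm
    -- It suffices to compare after `η`. There `τ λ_{n+2}` becomes `λ_{n+2}` followed by `ι_{n+1}`,
    -- and `hval` identifies this with the image of the evaluated cocycle.
    refine hP k ?_
    refine Eq.trans ?_ ((congrArg ((S.eta hn).app k) e₁).trans (S.eta_app hn hy)).symm
    refine (congrArg (fun φ => φ.app k z) hτ).trans ?_
    change ((gradedHom N).map (S.iota n)).app k
      ((e (n + 1)).inv.app k ((GrMod.kerι (R.d n).hom).app k z)) = _
    have e₂ : (R.d (n + 1)).hom.app k ((e (n + 2)).hom.app k x) =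
        (e (n + 1)).hom.app k (x ≫ lam (n + 1)) :=
      (congrArg (fun φ => φ.app k x) (he (n + 1))).symm
    have e₃ : (e (n + 1)).inv.app k ((e (n + 1)).hom.app k (x ≫ lam (n + 1))) =
        x ≫ lam (n + 1) :=
      congrArg (fun φ => φ.app k (x ≫ lam (n + 1))) (e (n + 1)).hom_inv_id
    rw [hz, e₂, e₃]
    exact Category.assoc _ _ _

end PostnikovSystem

end Triangulated

theorem mainTheorem2 {C : Type u} [Category.{v} C] [Preadditive C] [HasZeroObject C]
    [HasShift C ℤ] [∀ k : ℤ, (shiftFunctor C k).Additive] [Pretriangulated C] [IsTriangulated C]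
    [HasCoproducts.{v} C]
    (N : C) (hN : IsCompactObj N)
    (n : ℕ) (hn : 1 ≤ n) (hsparse : IsSparse n (endRing N).carrier)
    (M : GrMod (endRing N)) (R : FreeResolution n M)
    (γ : HML (endRing N) n (n + 2) (-(n : ℤ)))
    (hγ : ∃ c : Cochain (homBimodule (endRing N) n (-(n : ℤ))) (n + 2),
      NormalizedRep c γ ∧ R.eval c ∈ ModTodaBracket n N R.F R.d n) :
    Nonempty (PostnikovSystem N M (n + 1)) ∧
    ∃ κ : YExt n M ((GrMod.shift (-(n : ℤ))).obj M),
      (∀ (S : PostnikovSystem N M (n + 1)) (ξ : YExt n M ((GrMod.shift (-(n : ℤ))).obj M)),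
        S.IsObstructionClass ξ ↔ ξ = κ) ∧
      (∀ ξ : YExt n M ((GrMod.shift (-(n : ℤ))).obj M), IsCupProduct n (𝟙 M) γ ξ ↔ ξ = κ) := by
  obtain ⟨c, hc, X, hX, lam, e, he, g, ⟨Z, g₀, g₁, h₀, h₁, rfl⟩, hg⟩ := hγ
  obtain ⟨Y, pi, iota, alpha, hpi, dist, comp, hsigma⟩ := Z.exists_tower g₀ h₀
  let S := PostnikovSystem.ofResolution R hX lam e he pi iota alpha hpi (k := n + 1)
    (fun j hj => dist j (by omega)) comp
  obtain ⟨u, hu⟩ : ∃ u : Z.F (n + 1) ⟶ Y 0, u ≫ pi 0 = g₀ := ⟨g₀ ≫ inv (pi 0), by simp⟩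
  have hS := hsigma S.alphaComp rfl (fun _ => rfl) u hu
  -- The bracket enters here: `g₁` lifts `λ_{n+2}[n]` through `σ`, so `ι_{n+1} λ_{n+2}` is, after
  -- suspension, the image under `α_n ⋯ α_1` of `g₁ ≫ u`, which represents the bracket element `g₁ ≫
  -- g₀`.
  have e₁ : (lam (n + 1) ≫ iota n)⟦(n : ℤ)⟧' = (g₁ ≫ u) ≫ S.alphaComp n := by
    rw [Functor.map_comp, ← h₁]
    exact (Category.assoc _ _ _).trans ((congrArg (g₁ ≫ ·) hS).trans (Category.assoc _ _ _).symm)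
  have e₂ : (g₁ ≫ u) ≫ pi 0 = g₁ ≫ g₀ := by rw [Category.assoc, hu]
  refine ⟨⟨S⟩, (S.obstruction hn).toExt, fun S' ξ => ?_, ?_⟩
  -- Every system receives a map from the constructed `S`, so two arbitrary systems never have to be
  -- compared directly.
  · obtain ⟨φ⟩ := PostnikovSystem.nonempty_map S S' (fun j _ => hX j) R.isSparse
    rw [S'.isObstructionClass_iff hn, φ.obstruction_toExt_eq hn]
  · refine S.isCupProduct_iff hn R lam e he rfl comp hc fun k x => ?_
    have hk : k + (n : ℤ) = k - -(n : ℤ) := by omega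
    refine ⟨suspend hk x ≫ g₁ ≫ u, ?_,
      (hg k x).trans (congrArg ((e 0).hom.app (k - -(n : ℤ))) ?_)⟩
    · exact (suspend_comp hk x _).trans
        ((congrArg (suspend hk x ≫ ·) e₁).trans (Category.assoc _ _ _).symm)
    · exact ((Category.assoc _ _ _).symm.trans (congrArg (suspend hk x ≫ ·) e₂.symm)).trans
        (Category.assoc _ _ _).symm
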